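/- Let $k$ be a commutative ring in which $2$ is invertible (for instance any commutative ring containing $\mathbb{Q}$), and let $(L,d,[\cdot,\cdot])$ be a differential $\mathbb{Z}$-graded Lie algebra over $k$, with $d$ of degree $+1$ and $[\cdot,\cdot]$ of degree $0$. Let $\eta:L\to L$ be a $k$-linear map of degree $-1$ with $d\eta d=d$, $\eta^2=0$ and $\eta d\eta=\eta$. Put $[d,\eta]=d\eta+\eta d$, $g=\eta[\cdot,\cdot]$, and $H=\ker[d,\eta]$ with the grading inherited from $L$. Notation. For homogeneous $a_1,\dots,a_n$ and $\sigma\in\Sigma_n$ let $\chi(\sigma)$ be the sign with $a_{\sigma(1)}\wedge\dots\wedge a_{\sigma(n)}=\chi(\sigma)\,a_1\wedge\dots\wedge a_n$ in the graded exterior algebra (where $a\wedge b=-(-1)^{|a||b|}b\wedge a$), and let $\alpha_n(a_1\otimes\dots\otimes a_n)=\sum_{\sigma\in\Sigma_n}\chi(\sigma)\,a_{\sigma(1)}\otimes\dots\otimes a_{\sigma(n)}$. Let $\mathrm{Sh}(p,n)\subset\Sigma_n$ be the set of permutations increasing on $\{1,\dots,p\}$ and on $\{p+1,\dots,n\}$.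 Let $\mathrm{Ot}(n)$ be the set of plane (oriented) binary trees with $n$ leaves; order the ramifications (internal vertices) and leaves of such a tree by listing the root first, then the left branch, then the right branch, recursively. Put $e(\phi)=(-1)^{w_\phi(1)+\dots+w_\phi(n)}$, where $w_\phi(i)=s_\phi(i)-(i-1)$ and $s_\phi(i)$ is the number of ramifications smaller than the $i$-th leaf. For a family $B=(b_K)$ of homogeneous bilinear maps $L\otimes L\to L$ indexed by the ramifications of $\phi$, written in the above order, let $\phi(B):L^{\otimes n}\to L$ be defined recursively: it is the identity for the tree with one leaf, and $\phi(B)=b_{\mathrm{root}}\circ(\phi_1(B_1)\otimes\phi_2(B_2))$ if $\phi$ has left branch $\phi_1$ and right branch $\phi_2$, with the Koszul convention $(f\otimes h)(x\otimes y)=(-1)^{|h||x|}f(x)\otimes h(y)$. Theorem. There are graded antisymmetric $k$-multilinear maps $\mu_n:H^{\otimes n}\to H$ of degree $2-n$ ($n\ge 0$), with $\mu_0=0$, $\mu_1=0$ and $$\mu_2=(1-d\eta)[\cdot,\cdot],\qquad \mu_n=\Big(\frac{-1}{2}\Big)^{n-1}\sum_{\phi\in\mathrm{Ot}(n)}e(\phi)\,\phi\big((1-[d,\eta])[\cdot,\cdot],g,\dots,g\big)\circ\alpha_n\quad\text{for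 all } n\ge 2$$ (in particular the two expressions for $\mu_2$ agree on $H$ and the right-hand sides take values in $H$), and these maps form a minimal $L_\infty$-algebra structure on the graded module $H$: for all $n\ge 0$ and all homogeneous $a_1,\dots,a_n\in H$, $$\sum_{p+l=n+1}\ \sum_{\sigma\in\mathrm{Sh}(p,n)}(-1)^{p(l-1)}\chi(\sigma)\,\mu_l\big(\mu_p(a_{\sigma(1)},\dots,a_{\sigma(p)}),a_{\sigma(p+1)},\dots,a_{\sigma(n)}\big)=0,$$ where $p\ge 0$ and $l\ge 1$. -/

import Mathlib

open scoped BigOperators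

/-! ### Koszul signs and shuffles -/

/-- The sign `χ(σ; a₁,…,aₙ)` with `a_{σ(1)} ∧ … ∧ a_{σ(n)} = χ(σ) a₁ ∧ … ∧ aₙ` in the graded exterior
algebra (relations `a ∧ b = -(-1)^{|a||b|} b ∧ a`), where `deg i` is the degree of `aᵢ`:
every inversion of `σ` contributes the factor `-(-1)^{|a||b|}`. -/
def koszulChi {n : ℕ} (σ : Equiv.Perm (Fin n)) (deg : Fin n → ℤ) : ℤˣ :=
  ∏ i : Fin n, ∏ j : Fin n,
    if i < j ∧ σ j < σ i then -Int.negOnePow (deg (σ i) * deg (σ j)) else 1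

/-- The shuffles `Sh(k,n)`: permutations of `n` letters that are increasing on the first `k`
positions and increasing on the last `n - k` positions. -/
def shuffles (k n : ℕ) : Finset (Equiv.Perm (Fin n)) :=
  Finset.univ.filter fun σ =>
    (∀ i j : Fin n, i < j → j.val < k → σ i < σ j) ∧
    (∀ i j : Fin n, k ≤ i.val → i < j → σ i < σ j)

/-! ### `L_∞`-algebras -/

/-- The sequence of `n`-ary maps `μ n` (`n ≥ 0`) is an `L_∞`-algebra structure on the
`ℤ`-graded `k`-module `V = ⨁ gr i`. -/
structure IsLInfinityAlgebra {k V : Type*} [CommRing k] [AddCommGroup V] [Module k V]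
    (gr : ℤ → Submodule k V) (μ : (n : ℕ) → MultilinearMap k (fun _ : Fin n => V) V) : Prop where
  isInternal : DirectSum.IsInternal gr
  /-- `μ n` has degree `2 - n`. -/
  degree : ∀ (n : ℕ) (deg : Fin n → ℤ) (a : Fin n → V), (∀ i, a i ∈ gr (deg i)) →
    μ n a ∈ gr (∑ i, deg i + 2 - n)
  /-- `μ n` is graded antisymmetric. -/
  antisymm : ∀ (n : ℕ) (deg : Fin n → ℤ) (a : Fin n → V), (∀ i, a i ∈ gr (deg i)) →
    ∀ σ : Equiv.Perm (Fin n), μ n (fun i => a (σ i)) = koszulChi σ deg • μ n a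
  /-- The generalised Jacobi identities
  `∑_{p+l=n+1} ∑_{σ ∈ Sh(p,n)} (-1)^{p(l-1)} χ(σ) μ_l(μ_p(a_{σ1},…,a_{σp}),a_{σ(p+1)},…,a_{σn}) = 0`
  (here `l = n - p + 1`). -/
  jacobi : ∀ (n : ℕ) (deg : Fin n → ℤ) (a : Fin n → V), (∀ i, a i ∈ gr (deg i)) →
    ∑ p : Fin (n + 1), ∑ σ ∈ shuffles p n,
      (Int.negOnePow ((p : ℤ) * ((n - p : ℕ) : ℤ)) * koszulChi σ deg) •
        μ (n - p + 1)
          (Fin.cons (μ p (fun i : Fin p => a (σ ⟨i.val, by omega⟩)))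
            (fun j : Fin (n - p) => a (σ ⟨p.val + j.val, by omega⟩))) = 0

/-- An `L_∞`-structure is minimal if it is uncurved (`μ₀ = 0`) and `μ₁ = 0`. -/
structure IsMinimalLInfinityAlgebra {k V : Type*} [CommRing k] [AddCommGroup V] [Module k V]
    (gr : ℤ → Submodule k V) (μ : (n : ℕ) → MultilinearMap k (fun _ : Fin n => V) V) : Prop
    extends IsLInfinityAlgebra gr μ where
  mu_zero : μ 0 = 0
  mu_one : μ 1 = 0

/-! ### Differential graded Lie algebras and splittings -/

/-- A differential graded Lie algebra structure on the `k`-module `L`, with a differential of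
degree `+1` and a bracket of degree `0`. -/
structure DGLieAlgebra (k L : Type*) [CommRing k] [AddCommGroup L] [Module k L] where
  gr : ℤ → Submodule k L
  isInternal : DirectSum.IsInternal gr
  d : L →ₗ[k] L
  bracket : L →ₗ[k] L →ₗ[k] L
  d_mem : ∀ (i : ℤ) (a : L), a ∈ gr i → d a ∈ gr (i + 1)
  d_d : ∀ a : L, d (d a) = 0
  bracket_mem : ∀ (i j : ℤ) (a b : L), a ∈ gr i → b ∈ gr j → bracket a b ∈ gr (i + j)
  bracket_antisymm : ∀ (i j : ℤ) (a b : L), a ∈ gr i → b ∈ gr j →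
    bracket a b = -(Int.negOnePow (i * j) • bracket b a)
  bracket_jacobi : ∀ (i j l : ℤ) (a b c : L), a ∈ gr i → b ∈ gr j → c ∈ gr l →
    bracket a (bracket b c) =
      bracket (bracket a b) c + Int.negOnePow (i * j) • bracket b (bracket a c)
  d_bracket : ∀ (i : ℤ) (a b : L), a ∈ gr i →
    d (bracket a b) = bracket (d a) b + Int.negOnePow i • bracket a (d b)

/-- A map `η` of degree `-1` with `dηd = d`, `η² = 0` and `ηdη = η`. -/
structure DGLieAlgebra.IsSplitting {k L : Type*} [CommRing k] [AddCommGroup L] [Module k L]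
    (A : DGLieAlgebra k L) (η : L →ₗ[k] L) : Prop where
  eta_mem : ∀ (i : ℤ) (a : L), a ∈ A.gr i → η a ∈ A.gr (i - 1)
  d_eta_d : ∀ a : L, A.d (η (A.d a)) = A.d a
  eta_eta : ∀ a : L, η (η a) = 0
  eta_d_eta : ∀ a : L, η (A.d (η a)) = η a

/-- The graded commutator `[d,η] = dη + ηd` (both maps are odd). -/
def DGLieAlgebra.comm {k L : Type*} [CommRing k] [AddCommGroup L] [Module k L]
    (A : DGLieAlgebra k L) (η : L →ₗ[k] L) : L →ₗ[k] L :=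
  A.d ∘ₗ η + η ∘ₗ A.d

/-- `H = ker [d,η]`. -/
def DGLieAlgebra.H {k L : Type*} [CommRing k] [AddCommGroup L] [Module k L]
    (A : DGLieAlgebra k L) (η : L →ₗ[k] L) : Submodule k L :=
  LinearMap.ker (A.comm η)

/-- The grading of `H` inherited from `L`. -/
def DGLieAlgebra.grH {k L : Type*} [CommRing k] [AddCommGroup L] [Module k L]
    (A : DGLieAlgebra k L) (η : L →ₗ[k] L) (i : ℤ) : Submodule k (A.H η) :=
  (A.gr i).comap (A.H η).subtype

/-! ### Oriented binary trees -/

/-- Equivalence classes of oriented binary trees with `n` leaves, i.e. plane binary trees: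
`nil` is the tree `τ` with one leaf and no ramification, `node _ φ₁ φ₂` has a root ramification with
left branch `φ₁` and right branch `φ₂`. -/
abbrev Ot (n : ℕ) : Type := {φ : BinaryTree Unit // φ.numLeaves = n}

instance Ot.fintype (n : ℕ) : Fintype (Ot n) :=
  match n with
  | 0 => ⟨∅, fun φ => absurd φ.2 φ.1.numLeaves_pos.ne'⟩
  | m + 1 => Fintype.subtype (BinaryTree.treesOfNumNodesEq m) fun φ => by
      rw [BinaryTree.mem_treesOfNumNodesEq, φ.numLeaves_eq_numNodes_succ, Nat.succ_inj]

/-- The list, over the leaves from left to right, of the numbers `s_φ(i)` of ramifications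
smaller than the `i`-th leaf. In the order on ramifications and leaves the root comes first, then
the left branch, then the right branch. -/
def ramificationsBefore : BinaryTree Unit → List ℕ
  | .nil => [0]
  | .node _ l r =>
      (ramificationsBefore l).map (fun s => s + 1) ++
        (ramificationsBefore r).map (fun s => s + (l.numNodes + 1))

/-- `e(φ) = (-1)^{w_φ(1)+…+w_φ(n)}`, where `w_φ(i) = s_φ(i) - (i - 1)`; in the list below
the positions are numbered from `0`. -/
def treeSign (φ : BinaryTree Unit) : ℤˣ :=
  Int.negOnePow
    (((ramificationsBefore φ).zipIdx.map fun p => (p.1 : ℤ) - (p.2 : ℤ)).sum)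

/-- A homogeneous bilinear map `L ⊗ L → L`, with its degree. -/
structure HomogeneousBilin {k L : Type*} [CommRing k] [AddCommGroup L] [Module k L]
    (gr : ℤ → Submodule k L) where
  deg : ℤ
  map : L →ₗ[k] L →ₗ[k] L
  map_mem : ∀ (i j : ℤ) (a b : L), a ∈ gr i → b ∈ gr j → map a b ∈ gr (i + j + deg)

/-- The degree of `φ(B)`: the sum of the degrees of all `b_K`. -/
def treeDegree {k L : Type*} [CommRing k] [AddCommGroup L] [Module k L]
    {gr : ℤ → Submodule k L} : BinaryTree (HomogeneousBilin gr) → ℤ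
  | .nil => 0
  | .node b l r => b.deg + treeDegree l + treeDegree r

/-- The value `φ(B)(a₁ ⊗ … ⊗ aₙ)` on homogeneous elements `aᵢ` of degree `deg i`, for a tree whose
ramifications `K` carry homogeneous bilinear maps `b_K`: `τ` gives the identity, and
`(φ₁ + φ₂)(B) = b₀ ∘ (φ₁(B₁) ⊗ φ₂(B₂))` with the Koszul convention
`(f ⊗ g)(x ⊗ y) = (-1)^{|g||x|} f(x) ⊗ g(y)`. -/
def treeEval {k L : Type*} [CommRing k] [AddCommGroup L] [Module k L]
    {gr : ℤ → Submodule k L} :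
    (φ : BinaryTree (HomogeneousBilin gr)) → (Fin φ.numLeaves → ℤ) → (Fin φ.numLeaves → L) → L
  | .nil, _, a => a (0 : Fin 1)
  | .node b l r, deg, a =>
      Int.negOnePow (treeDegree r * ∑ i : Fin l.numLeaves, deg (Fin.castAdd r.numLeaves i)) •
        b.map
          (treeEval l (fun i => deg (Fin.castAdd r.numLeaves i))
            (fun i => a (Fin.castAdd r.numLeaves i)))
          (treeEval r (fun i => deg (Fin.natAdd l.numLeaves i))
            (fun i => a (Fin.natAdd l.numLeaves i)))

/-- Put `b₀` on the root of a tree and `b` on all other ramifications. -/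
def decorate {β : Type*} (b₀ b : β) : BinaryTree Unit → BinaryTree β
  | .nil => .nil
  | .node _ l r => .node b₀ (l.map fun _ => b) (r.map fun _ => b)

theorem numLeaves_map_const {β : Type*} (b : β) (φ : BinaryTree Unit) :
    (φ.map fun _ => b).numLeaves = φ.numLeaves := by
  induction φ with
  | nil => rfl
  | node u l r ihl ihr => simp only [BinaryTree.map, BinaryTree.numLeaves, ihl, ihr]

theorem numLeaves_decorate {β : Type*} (b₀ b : β) (φ : BinaryTree Unit) :
    (decorate b₀ b φ).numLeaves = φ.numLeaves := by
  cases φ with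
  | nil => rfl
  | node u l r => simp only [decorate, BinaryTree.numLeaves, numLeaves_map_const]

/-! ### The brackets on `H` -/

/-- `g = η[·,·]`, of degree `-1`. -/
def DGLieAlgebra.IsSplitting.g {k L : Type*} [CommRing k] [AddCommGroup L] [Module k L]
    {A : DGLieAlgebra k L} {η : L →ₗ[k] L} (hη : A.IsSplitting η) : HomogeneousBilin A.gr where
  deg := -1
  map := A.bracket.compr₂ η
  map_mem i j a b ha hb := hη.eta_mem (i + j) _ (A.bracket_mem i j a b ha hb)

/-- `(1 - [d,η])[·,·]`, of degree `0`. -/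
def DGLieAlgebra.IsSplitting.projBracket {k L : Type*} [CommRing k] [AddCommGroup L] [Module k L]
    {A : DGLieAlgebra k L} {η : L →ₗ[k] L} (hη : A.IsSplitting η) : HomogeneousBilin A.gr where
  deg := 0
  map := A.bracket.compr₂ (LinearMap.id - A.comm η)
  map_mem i j a b ha hb := by
    have h := A.bracket_mem i j a b ha hb
    have h1 := A.d_mem _ _ (hη.eta_mem _ _ h)
    have h2 := hη.eta_mem _ _ (A.d_mem _ _ h)
    rw [sub_add_cancel] at h1
    rw [add_sub_cancel_right] at h2
    rw [add_zero]
    exact Submodule.sub_mem _ h (Submodule.add_mem _ h1 h2)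

/-- The value on homogeneous `a₁,…,aₙ` (of degrees `deg i`) of
`(-1/2)^{n-1} ∑_{φ ∈ Ot(n)} e(φ) φ((1-[d,η])[·,·], g, …, g) ∘ αₙ`, where
`αₙ(a₁ ⊗ … ⊗ aₙ) = ∑_σ χ(σ) a_{σ(1)} ⊗ … ⊗ a_{σ(n)}`. -/
def DGLieAlgebra.IsSplitting.treeBracket {k L : Type*} [CommRing k] [Invertible (2 : k)]
    [AddCommGroup L] [Module k L] {A : DGLieAlgebra k L} {η : L →ₗ[k] L}
    (hη : A.IsSplitting η) (n : ℕ) (deg : Fin n → ℤ) (a : Fin n → L) : L :=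
  (-⅟(2 : k)) ^ (n - 1) • ∑ φ : Ot n, treeSign φ.1 •
    ∑ σ : Equiv.Perm (Fin n), koszulChi σ deg •
      treeEval (decorate hη.projBracket hη.g φ.1)
        (fun i => deg (σ (Fin.cast ((numLeaves_decorate _ _ φ.1).trans φ.2) i)))
        (fun i => a (σ (Fin.cast ((numLeaves_decorate _ _ φ.1).trans φ.2) i)))

/-!
Let `R` be a graded commutative algebra. On `R ⊗ L`, graded by the total degree, the bracket
`[r ⊗ u, s ⊗ v] = (-1)^|u| r s ⊗ [u, v]` is symmetric on the part of degree `1`, and `d`, `η`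
extend to it. Given homogeneous `a₁, …, aₙ ∈ H`, let `R` be generated by square zero elements `ε_j`
of degree `1 - |a_j|`, so that the generic element `x = ∑ ε_j ⊗ a_j` has degree `1`. Solve
`t = x + ½ η[t, t]` by power series. The coefficients of the Kuranishi map
`F(x) = ½ (1 - [d, η])[t, t]` are the sums over trees which define the brackets `μₙ`.

The curvature `c = dt - ½ [t, t]` satisfies the Bianchi identity, which gives `c = -F(x) + η[c, t]`.
So `-c` solves the equation `w = y + η[w, t]` for the derivative of `t` in the direction `y = F(x)`,
and the derivative of `F` at `x` in this direction is
`-(1 - [d, η])[c, t] = ½ (1 - [d, η]) d [t, t] = 0`. Taking directional derivatives with a further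
generator `ζ`, the coefficient of `ζ ε₁ ⋯ εₙ` is the generalised Jacobi identity.
-/

open scoped TensorProduct
open Finset.HasAntidiagonal (antidiagonal mem_antidiagonal)

/-! ### Nested antidiagonal sums -/

theorem sum_antidiagonal_assoc {M : Type*} [AddCommMonoid M] (f : ℕ → ℕ → ℕ → M) (n : ℕ) :
    ∑ ij ∈ antidiagonal n, ∑ ab ∈ antidiagonal ij.1, f ab.1 ab.2 ij.2 =
      ∑ ij ∈ antidiagonal n, ∑ ab ∈ antidiagonal ij.2, f ij.1 ab.1 ab.2 := by
  rw [Finset.sum_sigma', Finset.sum_sigma']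
  refine Finset.sum_bij' (fun s _ => ⟨(s.2.1, s.2.2 + s.1.2), (s.2.2, s.1.2)⟩)
    (fun s _ => ⟨(s.1.1 + s.2.1, s.2.2), (s.1.1, s.2.1)⟩) ?_ ?_ ?_ ?_ ?_ <;>
  · rintro ⟨⟨i, j⟩, a, b⟩ h
    obtain ⟨rfl, rfl⟩ := by simpa only [Finset.mem_sigma, mem_antidiagonal] using h
    simp only [Finset.mem_sigma, mem_antidiagonal, add_assoc, and_self]

theorem sum_antidiagonal_rotate {M : Type*} [AddCommMonoid M] (f : ℕ → ℕ → ℕ → M) (n : ℕ) :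
    ∑ ij ∈ antidiagonal n, ∑ ab ∈ antidiagonal ij.1, f ab.1 ab.2 ij.2 =
      ∑ ij ∈ antidiagonal n, ∑ ab ∈ antidiagonal ij.1, f ab.2 ij.2 ab.1 :=
  calc ∑ ij ∈ antidiagonal n, ∑ ab ∈ antidiagonal ij.1, f ab.1 ab.2 ij.2
      = ∑ ij ∈ antidiagonal n, ∑ ab ∈ antidiagonal ij.2, f ab.1 ab.2 ij.1 :=
        (Finset.Nat.sum_antidiagonal_swap (f := fun ij : ℕ × ℕ =>
          ∑ ab ∈ antidiagonal ij.1, f ab.1 ab.2 ij.2)).symm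
    _ = _ := (sum_antidiagonal_assoc (fun a b c => f b c a) n).symm

/-- On the diagonal, `hcyc` only gives `3 • f a a a = 0`. -/
theorem sum_antidiagonal_eq_zero_of_cyclic {M : Type*} [AddCommGroup M] (f : ℕ → ℕ → ℕ → M)
    (hdiag : ∀ a, f a a a = 0) (hcyc : ∀ a b c, f a b c + f b c a + f c a b = 0) (n : ℕ) :
    ∑ ij ∈ antidiagonal n, ∑ ab ∈ antidiagonal ij.1, f ab.1 ab.2 ij.2 = 0 := by
  -- Off the diagonal, exactly one rotation of a triple satisfies `P`.
  let P (a b c : ℕ) : Prop := a ≤ b ∧ a < c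
  let g (a b c : ℕ) : M := if P a b c then f a b c else 0
  let g' (a b c : ℕ) : M := if P b c a then f a b c else 0
  let g'' (a b c : ℕ) : M := if P c a b then f a b c else 0
  have split (a b c : ℕ) : f a b c = g a b c + g' a b c + g'' a b c := by
    by_cases h : a = b ∧ b = c
    · obtain ⟨rfl, rfl⟩ := h
      simp only [g, g', g'', hdiag, ite_self, add_zero]
    · have exactly_one : (P a b c ∧ ¬ P b c a ∧ ¬ P c a b) ∨ (¬ P a b c ∧ P b c a ∧ ¬ P c a b) ∨
          (¬ P a b c ∧ ¬ P b c a ∧ P c a b) := by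
        simp only [P]
        omega
      rcases exactly_one with ⟨h₁, h₂, h₃⟩ | ⟨h₁, h₂, h₃⟩ | ⟨h₁, h₂, h₃⟩ <;>
        simp only [g, g', g'', h₁, h₂, h₃, if_true, if_false, add_zero, zero_add]
  simp only [split, Finset.sum_add_distrib]
  rw [← sum_antidiagonal_rotate fun a b c => if P a b c then f c a b else 0,
    sum_antidiagonal_rotate g'', ← Finset.sum_add_distrib, ← Finset.sum_add_distrib]
  refine Finset.sum_eq_zero fun ij _ => ?_
  rw [← Finset.sum_add_distrib, ← Finset.sum_add_distrib]
  refine Finset.sum_eq_zero fun ab _ => ?_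
  simp only [g, g'']
  split_ifs
  · rw [← hcyc ab.1 ab.2 ij.2]
    abel
  · simp only [add_zero]

/-! ### Odd Lie brackets with a splitting of the differential -/

/-- A square zero map `d` with a splitting `η` and a bracket which, on the submodule `even`, has
the properties of the bracket of a desuspended differential graded Lie algebra on even elements. -/
structure SplitOddLie (k V : Type*) [CommRing k] [AddCommGroup V] [Module k V] where
  d : V →ₗ[k] V
  η : V →ₗ[k] V
  bracket : V →ₗ[k] V →ₗ[k] V
  even : Submodule k V
  d_d : ∀ v, d (d v) = 0
  d_eta_d : ∀ v, d (η (d v)) = d v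
  eta_bracket_mem : ∀ x ∈ even, ∀ y ∈ even, η (bracket x y) ∈ even
  symm : ∀ x ∈ even, ∀ y ∈ even, bracket x y = bracket y x
  jacobi : ∀ x ∈ even, ∀ y ∈ even, ∀ z ∈ even,
    bracket (bracket x y) z + bracket (bracket y z) x + bracket (bracket z x) y = 0
  cubic : ∀ x ∈ even, bracket (bracket x x) x = 0
  d_bracket : ∀ x ∈ even, ∀ y ∈ even, d (bracket x y) = -bracket (d x) y - bracket (d y) x

namespace SplitOddLie

variable {k V : Type*} [CommRing k] [AddCommGroup V] [Module k V] (Q : SplitOddLie k V)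

/-- The map `1 - [d,η]`, which kills the image of `d`. -/
def proj : V →ₗ[k] V := LinearMap.id - (Q.d ∘ₗ Q.η + Q.η ∘ₗ Q.d)

theorem proj_apply (v : V) : Q.proj v = v - (Q.d (Q.η v) + Q.η (Q.d v)) := rfl

theorem proj_d (v : V) : Q.proj (Q.d v) = 0 := by
  rw [proj_apply, Q.d_eta_d, Q.d_d, map_zero, add_zero, sub_self]

theorem bracket_add_self {Z : V →ₗ[k] V} (hZ : ∀ u v, Q.bracket (Z u) v = Z (Q.bracket u v))
    {t w : V} (ht : t ∈ Q.even) (hw : Z w ∈ Q.even) (hww : Q.bracket (Z w) (Z w) = 0) :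
    Q.bracket (t + Z w) (t + Z w) = Q.bracket t t + (2 : k) • Z (Q.bracket w t) := by
  rw [LinearMap.map_add₂, map_add, map_add, hww, Q.symm t ht _ hw, hZ, two_smul]
  abel

section Curvature

variable [Invertible (2 : k)]

/-- The curvature `dt - ½[t,t]`, whose vanishing is the Maurer–Cartan equation. -/
def curvature (t : V) : V := Q.d t - ⅟(2 : k) • Q.bracket t t

variable {t : V}

theorem bracket_d_self (ht : t ∈ Q.even) :
    Q.bracket (Q.d t) t = -(⅟(2 : k) • Q.d (Q.bracket t t)) := by
  rw [Q.d_bracket t ht t ht, ← neg_add', ← two_smul k, smul_neg, neg_neg, smul_smul,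
    invOf_mul_self, one_smul]

theorem bracket_curvature (ht : t ∈ Q.even) :
    Q.bracket (Q.curvature t) t = -(⅟(2 : k) • Q.d (Q.bracket t t)) := by
  rw [curvature, map_sub, LinearMap.sub_apply, map_smul, LinearMap.smul_apply, Q.cubic t ht,
    smul_zero, sub_zero, Q.bracket_d_self ht]

theorem proj_bracket_curvature (ht : t ∈ Q.even) :
    Q.proj (Q.bracket (Q.curvature t) t) = 0 := by
  rw [Q.bracket_curvature ht, map_neg, map_smul, proj_d, smul_zero, neg_zero]

theorem curvature_eq_of_fixed (ht : t ∈ Q.even) {x : V} (hx : Q.d x = 0)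
    (hfix : t = x + ⅟(2 : k) • Q.η (Q.bracket t t)) :
    Q.curvature t =
      -(⅟(2 : k) • Q.proj (Q.bracket t t)) + Q.η (Q.bracket (Q.curvature t) t) := by
  have hd : Q.d t = ⅟(2 : k) • Q.d (Q.η (Q.bracket t t)) :=
    (congrArg Q.d hfix).trans (by rw [map_add, hx, zero_add, map_smul])
  rw [Q.bracket_curvature ht, curvature, hd, proj_apply, map_neg, map_smul, smul_sub, smul_add]
  abel

end Curvature

/-! ### Formal power series -/

/-- The bracket on the sequences in `V`, regarded as formal power series in a parameter `ħ`, which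
is `ħ` times the series-linear extension of `B`. -/
def seriesBracket (B : V →ₗ[k] V →ₗ[k] V) : (ℕ → V) →ₗ[k] (ℕ → V) →ₗ[k] (ℕ → V) :=
  LinearMap.mk₂ k
    (fun u v m => match m with
      | 0 => 0
      | m + 1 => ∑ ij ∈ antidiagonal m, B (u ij.1) (v ij.2))
    (fun u u' v => funext fun m => by
      cases m <;> simp only [Pi.add_apply, map_add, LinearMap.add_apply, Finset.sum_add_distrib,
        add_zero])
    (fun c u v => funext fun m => by
      cases m <;> simp only [Pi.smul_apply, map_smul, LinearMap.smul_apply, Finset.smul_sum,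
        smul_zero])
    (fun u v v' => funext fun m => by
      cases m <;> simp only [Pi.add_apply, map_add, Finset.sum_add_distrib, add_zero])
    (fun c u v => funext fun m => by
      cases m <;> simp only [Pi.smul_apply, map_smul, Finset.smul_sum, smul_zero])

section seriesBracket

variable (B : V →ₗ[k] V →ₗ[k] V) (u v w : ℕ → V)

theorem seriesBracket_zero : seriesBracket B u v 0 = 0 := rfl

theorem seriesBracket_succ (m : ℕ) :
    seriesBracket B u v (m + 1) = ∑ ij ∈ antidiagonal m, B (u ij.1) (v ij.2) := rfl

theorem seriesBracket_seriesBracket_one :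
    seriesBracket B (seriesBracket B u v) w 1 = 0 := by
  rw [seriesBracket_succ, Finset.Nat.antidiagonal_zero, Finset.sum_singleton, seriesBracket_zero,
    map_zero, LinearMap.zero_apply]

theorem seriesBracket_seriesBracket_add_two (m : ℕ) :
    seriesBracket B (seriesBracket B u v) w (m + 2) =
      ∑ ij ∈ antidiagonal m, ∑ ab ∈ antidiagonal ij.1, B (B (u ab.1) (v ab.2)) (w ij.2) := by
  rw [seriesBracket_succ, Finset.Nat.sum_antidiagonal_succ, seriesBracket_zero, map_zero,
    LinearMap.zero_apply, zero_add]
  simp only [seriesBracket_succ, map_sum, LinearMap.sum_apply]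

variable {B u v w} {E : Submodule k V}

theorem seriesBracket_symm (hB : ∀ x ∈ E, ∀ y ∈ E, B x y = B y x) (hu : ∀ m, u m ∈ E)
    (hv : ∀ m, v m ∈ E) : seriesBracket B u v = seriesBracket B v u := by
  funext m
  cases m with
  | zero => rfl
  | succ m =>
    simp only [seriesBracket_succ]
    rw [← Finset.Nat.sum_antidiagonal_swap]
    exact Finset.sum_congr rfl fun ij _ => hB _ (hu _) _ (hv _)

theorem seriesBracket_jacobi
    (hB : ∀ x ∈ E, ∀ y ∈ E, ∀ z ∈ E, B (B x y) z + B (B y z) x + B (B z x) y = 0)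
    (hu : ∀ m, u m ∈ E) (hv : ∀ m, v m ∈ E) (hw : ∀ m, w m ∈ E) :
    seriesBracket B (seriesBracket B u v) w + seriesBracket B (seriesBracket B v w) u +
      seriesBracket B (seriesBracket B w u) v = 0 := by
  funext m
  rcases m with - | - | m
  · simp only [Pi.add_apply, seriesBracket_zero, add_zero, Pi.zero_apply]
  · simp only [Pi.add_apply, zero_add, seriesBracket_seriesBracket_one, add_zero, Pi.zero_apply]
  · simp only [Pi.add_apply, seriesBracket_seriesBracket_add_two]
    rw [sum_antidiagonal_rotate fun a b c => B (B (v a) (w b)) (u c),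
      ← sum_antidiagonal_rotate fun a b c => B (B (w c) (u a)) (v b),
      ← Finset.sum_add_distrib, ← Finset.sum_add_distrib]
    refine Finset.sum_eq_zero fun ij _ => ?_
    rw [← Finset.sum_add_distrib, ← Finset.sum_add_distrib]
    exact Finset.sum_eq_zero fun ab _ => hB _ (hu _) _ (hv _) _ (hw _)

theorem seriesBracket_cubic
    (hB : ∀ x ∈ E, ∀ y ∈ E, ∀ z ∈ E, B (B x y) z + B (B y z) x + B (B z x) y = 0)
    (hcubic : ∀ x ∈ E, B (B x x) x = 0) (hu : ∀ m, u m ∈ E) :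
    seriesBracket B (seriesBracket B u u) u = 0 := by
  funext m
  rcases m with - | - | m
  · rfl
  · exact seriesBracket_seriesBracket_one B u u u
  · rw [seriesBracket_seriesBracket_add_two]
    exact sum_antidiagonal_eq_zero_of_cyclic (fun a b c => B (B (u a) (u b)) (u c))
      (fun a => hcubic _ (hu a)) (fun a b c => hB _ (hu a) _ (hu b) _ (hu c)) m

theorem map_seriesBracket {d : V →ₗ[k] V}
    (hd : ∀ x ∈ E, ∀ y ∈ E, d (B x y) = -B (d x) y - B (d y) x)
    (hu : ∀ m, u m ∈ E) (hv : ∀ m, v m ∈ E) :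
    d.compLeft ℕ (seriesBracket B u v) =
      -seriesBracket B (d.compLeft ℕ u) v - seriesBracket B (d.compLeft ℕ v) u := by
  funext m
  simp only [LinearMap.compLeft_apply, Function.comp_apply, Pi.sub_apply, Pi.neg_apply]
  cases m with
  | zero => simp only [seriesBracket_zero, map_zero, neg_zero, sub_zero]
  | succ m =>
    simp only [seriesBracket_succ, map_sum, hd _ (hu _) _ (hv _), Finset.sum_sub_distrib,
      Finset.sum_neg_distrib]
    exact congrArg (_ - ·)
      (Finset.Nat.sum_antidiagonal_swap (f := fun ij : ℕ × ℕ => B (d (v ij.1)) (u ij.2)))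

end seriesBracket

/-- The odd Lie structure on formal power series whose bracket is multiplied by the parameter, so
that `ad t` raises the order and equations such as `w = x + η[w,t]` have unique solutions. -/
def series : SplitOddLie k (ℕ → V) where
  d := Q.d.compLeft ℕ
  η := Q.η.compLeft ℕ
  bracket := seriesBracket Q.bracket
  even := Submodule.pi Set.univ fun _ => Q.even
  d_d v := funext fun m => Q.d_d (v m)
  d_eta_d v := funext fun m => Q.d_eta_d (v m)
  eta_bracket_mem u hu v hv := by
    rintro (- | m) -
    · exact (congrArg (· ∈ Q.even) Q.η.map_zero).mpr Q.even.zero_mem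
    · change Q.η (∑ ij ∈ antidiagonal m, Q.bracket (u ij.1) (v ij.2)) ∈ Q.even
      rw [map_sum]
      exact Q.even.sum_mem fun ij _ =>
        Q.eta_bracket_mem _ (hu _ trivial) _ (hv _ trivial)
  symm u hu v hv :=
    seriesBracket_symm Q.symm (fun m => hu m trivial) fun m => hv m trivial
  jacobi u hu v hv w hw :=
    seriesBracket_jacobi Q.jacobi (fun m => hu m trivial) (fun m => hv m trivial)
      fun m => hw m trivial
  cubic u hu := seriesBracket_cubic Q.jacobi Q.cubic fun m => hu m trivial
  d_bracket u hu v hv :=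
    map_seriesBracket Q.d_bracket (fun m => hu m trivial) fun m => hv m trivial

theorem series_eta_apply (u : ℕ → V) (m : ℕ) : Q.series.η u m = Q.η (u m) := rfl

theorem series_d_apply (u : ℕ → V) (m : ℕ) : Q.series.d u m = Q.d (u m) := rfl

theorem series_proj_apply (u : ℕ → V) (m : ℕ) : Q.series.proj u m = Q.proj (u m) := rfl

theorem series_bracket_zero (u v : ℕ → V) : Q.series.bracket u v 0 = 0 := rfl

theorem series_bracket_succ (u v : ℕ → V) (m : ℕ) :
    Q.series.bracket u v (m + 1) = ∑ ij ∈ antidiagonal m, Q.bracket (u ij.1) (v ij.2) := rfl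

theorem series_mem_even {u : ℕ → V} : u ∈ Q.series.even ↔ ∀ m, u m ∈ Q.even :=
  ⟨fun h m => h m trivial, fun h m _ => h m⟩

theorem eq_zero_of_eq_eta_bracket {t w : ℕ → V} (h : w = Q.series.η (Q.series.bracket w t)) :
    w = 0 := by
  funext m
  induction m using Nat.strong_induction_on with
  | _ m ih =>
    rw [h, series_eta_apply]
    cases m with
    | zero => rw [series_bracket_zero, map_zero, Pi.zero_apply]
    | succ m =>
      rw [series_bracket_succ, Finset.sum_eq_zero, map_zero, Pi.zero_apply]
      intro ij hij
      rw [ih ij.1 (Finset.Nat.antidiagonal.fst_lt hij), Pi.zero_apply, map_zero,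
        LinearMap.zero_apply]

/-! ### The Kuranishi map -/

section Kuranishi

variable [Invertible (2 : k)]

/-- The solution `t` of `t = x + ½ η[t,t]` in formal power series; its `m`-th coefficient has `m`
brackets. -/
def fixedPoint (x : V) : ℕ → V
  | 0 => x
  | m + 1 =>
    ⅟(2 : k) • Q.η (∑ i : Fin (m + 1), Q.bracket (fixedPoint x i) (fixedPoint x (m - i)))

/-- The coefficients of `fixedPointDeriv`. -/
def fixedPointDerivCoeff (x : V) : ℕ → V →ₗ[k] V
  | 0 => LinearMap.id
  | m + 1 => Q.η ∘ₗ ∑ i : Fin (m + 1),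
      Q.bracket.flip (Q.fixedPoint x (m - i)) ∘ₗ fixedPointDerivCoeff x i

/-- The derivative of `fixedPoint` at `x`. -/
def fixedPointDeriv (x : V) : V →ₗ[k] ℕ → V := LinearMap.pi (Q.fixedPointDerivCoeff x)

/-- The Kuranishi map `½ (1 - [d,η])[t,t]`, where `t` is the solution of `t = x + ½ η[t,t]`. -/
def kuranishi (x : V) : ℕ → V :=
  ⅟(2 : k) • Q.series.proj (Q.series.bracket (Q.fixedPoint x) (Q.fixedPoint x))

/-- The derivative of the Kuranishi map at `x`. -/
def kuranishiDeriv (x : V) : V →ₗ[k] ℕ → V :=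
  Q.series.proj ∘ₗ Q.series.bracket.flip (Q.fixedPoint x) ∘ₗ Q.fixedPointDeriv x

theorem fixedPoint_zero (x : V) : Q.fixedPoint x 0 = x := by rw [fixedPoint]

theorem fixedPoint_succ (x : V) (m : ℕ) :
    Q.fixedPoint x (m + 1) =
      ⅟(2 : k) • Q.η (Q.series.bracket (Q.fixedPoint x) (Q.fixedPoint x) (m + 1)) := by
  rw [fixedPoint, series_bracket_succ, Finset.Nat.sum_antidiagonal_eq_sum_range_succ_mk,
    Finset.sum_range]

theorem fixedPoint_eq (x : V) : Q.fixedPoint x =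
    Pi.single 0 x +
      ⅟(2 : k) • Q.series.η (Q.series.bracket (Q.fixedPoint x) (Q.fixedPoint x)) := by
  funext m
  cases m with
  | zero =>
    simp only [Pi.add_apply, Pi.smul_apply, series_eta_apply, series_bracket_zero, map_zero,
      smul_zero, Pi.single_eq_same, add_zero, fixedPoint_zero]
  | succ m =>
    simp only [Pi.add_apply, Pi.smul_apply, series_eta_apply, fixedPoint_succ,
      Pi.single_eq_of_ne (Nat.succ_ne_zero m), zero_add]

theorem eq_fixedPoint {x : V} {s : ℕ → V}
    (h : s = Pi.single 0 x + ⅟(2 : k) • Q.series.η (Q.series.bracket s s)) :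
    s = Q.fixedPoint x := by
  funext m
  induction m using Nat.strong_induction_on with
  | _ m ih =>
    rw [h, fixedPoint_eq]
    simp only [Pi.add_apply, Pi.smul_apply, series_eta_apply]
    cases m with
    | zero => rfl
    | succ m =>
      rw [series_bracket_succ, series_bracket_succ]
      congr 3
      refine Finset.sum_congr rfl fun ij hij => ?_
      rw [ih _ (Finset.Nat.antidiagonal.fst_lt hij),
        ih _ (Finset.Nat.antidiagonal.snd_lt hij)]

theorem fixedPoint_mem {x : V} (hx : x ∈ Q.even) : Q.fixedPoint x ∈ Q.series.even := by
  refine Q.series_mem_even.2 fun m => ?_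
  induction m using Nat.strong_induction_on with
  | _ m ih =>
    cases m with
    | zero => rwa [fixedPoint_zero]
    | succ m =>
      rw [fixedPoint_succ, series_bracket_succ, map_sum]
      exact Q.even.smul_mem _ (Q.even.sum_mem fun ij hij => Q.eta_bracket_mem
        _ (ih _ (Finset.Nat.antidiagonal.fst_lt hij))
        _ (ih _ (Finset.Nat.antidiagonal.snd_lt hij)))

theorem fixedPointDeriv_zero (x y : V) : Q.fixedPointDeriv x y 0 = y := by
  rw [fixedPointDeriv, LinearMap.pi_apply, fixedPointDerivCoeff, LinearMap.id_apply]

theorem fixedPointDeriv_succ (x y : V) (m : ℕ) :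
    Q.fixedPointDeriv x y (m + 1) =
      Q.η (Q.series.bracket (Q.fixedPointDeriv x y) (Q.fixedPoint x) (m + 1)) := by
  rw [fixedPointDeriv, LinearMap.pi_apply, fixedPointDerivCoeff, LinearMap.comp_apply,
    LinearMap.sum_apply, series_bracket_succ, Finset.Nat.sum_antidiagonal_eq_sum_range_succ_mk,
    Finset.sum_range]
  rfl

theorem fixedPointDeriv_eq (x y : V) : Q.fixedPointDeriv x y =
    Pi.single 0 y + Q.series.η (Q.series.bracket (Q.fixedPointDeriv x y) (Q.fixedPoint x)) := by
  funext m
  cases m with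
  | zero =>
    simp only [Pi.add_apply, series_eta_apply, series_bracket_zero, map_zero,
      Pi.single_eq_same, add_zero, fixedPointDeriv_zero]
  | succ m =>
    simp only [Pi.add_apply, series_eta_apply, fixedPointDeriv_succ,
      Pi.single_eq_of_ne (Nat.succ_ne_zero m), zero_add]

theorem kuranishi_zero (x : V) : Q.kuranishi x 0 = 0 := by
  rw [kuranishi, Pi.smul_apply, series_proj_apply, series_bracket_zero, map_zero, smul_zero]

theorem kuranishi_succ (x : V) (m : ℕ) :
    Q.kuranishi x (m + 1) =
      ⅟(2 : k) • Q.proj (Q.series.bracket (Q.fixedPoint x) (Q.fixedPoint x) (m + 1)) := rfl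

theorem kuranishiDeriv_apply (x y : V) (m : ℕ) :
    Q.kuranishiDeriv x y m =
      Q.proj (Q.series.bracket (Q.fixedPointDeriv x y) (Q.fixedPoint x) m) := rfl

theorem kuranishiDeriv_zero (x y : V) : Q.kuranishiDeriv x y 0 = 0 := by
  rw [kuranishiDeriv_apply, series_bracket_zero, map_zero]

/-- The series-linear extension of `fixedPointDeriv x`, applied to the series `y`. -/
def fixedPointDerivSeries (x : V) (y : ℕ → V) (m : ℕ) : V :=
  ∑ ij ∈ antidiagonal m, Q.fixedPointDeriv x (y ij.1) ij.2

theorem sum_bracket_fixedPointDeriv (x : V) (y : ℕ → V) (m : ℕ) :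
    ∑ ij ∈ antidiagonal m,
        Q.series.bracket (Q.fixedPointDeriv x (y ij.1)) (Q.fixedPoint x) ij.2 =
      Q.series.bracket (Q.fixedPointDerivSeries x y) (Q.fixedPoint x) m := by
  cases m with
  | zero => rw [Finset.Nat.antidiagonal_zero, Finset.sum_singleton]; rfl
  | succ m =>
    rw [Finset.Nat.sum_antidiagonal_succ', series_bracket_zero, zero_add]
    simp only [series_bracket_succ, fixedPointDerivSeries, map_sum, LinearMap.sum_apply]
    exact (sum_antidiagonal_assoc
      (fun a b c => Q.bracket (Q.fixedPointDeriv x (y a) b) (Q.fixedPoint x c)) m).symm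

theorem fixedPointDerivSeries_eq (x : V) (y : ℕ → V) :
    Q.fixedPointDerivSeries x y =
      y + Q.series.η (Q.series.bracket (Q.fixedPointDerivSeries x y) (Q.fixedPoint x)) := by
  funext m
  rw [Pi.add_apply, series_eta_apply, ← sum_bracket_fixedPointDeriv]
  cases m with
  | zero =>
    simp only [fixedPointDerivSeries, Finset.Nat.antidiagonal_zero, Finset.sum_singleton,
      fixedPointDeriv_zero, series_bracket_zero, map_zero, add_zero]
  | succ m =>
    rw [fixedPointDerivSeries, Finset.Nat.sum_antidiagonal_succ',
      Finset.Nat.sum_antidiagonal_succ']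
    simp only [fixedPointDeriv_zero, fixedPointDeriv_succ, series_bracket_zero, map_sum, zero_add]

theorem fixedPointDerivSeries_kuranishi {x : V} (hx : x ∈ Q.even) (hd : Q.d x = 0) :
    Q.fixedPointDerivSeries x (Q.kuranishi x) = -Q.series.curvature (Q.fixedPoint x) := by
  have hdx : Q.series.d (Pi.single 0 x) = 0 := by
    funext m
    rw [series_d_apply]
    cases m with
    | zero => rw [Pi.single_eq_same, hd, Pi.zero_apply]
    | succ m => rw [Pi.single_eq_of_ne (Nat.succ_ne_zero m), map_zero, Pi.zero_apply]
  have hcurv := Q.series.curvature_eq_of_fixed (Q.fixedPoint_mem hx) hdx (Q.fixedPoint_eq x)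
  have hderiv := Q.fixedPointDerivSeries_eq x (Q.kuranishi x)
  refine eq_neg_of_add_eq_zero_left (Q.eq_zero_of_eq_eta_bracket (t := Q.fixedPoint x) ?_)
  nth_rewrite 1 [hderiv, hcurv]
  rw [map_add, LinearMap.add_apply, map_add, kuranishi]
  abel

theorem sum_kuranishiDeriv_kuranishi {x : V} (hx : x ∈ Q.even) (hd : Q.d x = 0) (m : ℕ) :
    ∑ ij ∈ antidiagonal m, Q.kuranishiDeriv x (Q.kuranishi x ij.1) ij.2 = 0 := by
  simp only [kuranishiDeriv_apply]
  rw [← map_sum, sum_bracket_fixedPointDeriv, Q.fixedPointDerivSeries_kuranishi hx hd, map_neg,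
    LinearMap.neg_apply, Pi.neg_apply, map_neg, ← series_proj_apply,
    Q.series.proj_bracket_curvature (Q.fixedPoint_mem hx), Pi.zero_apply, neg_zero]

section FirstOrder

variable {Q} {Z : V →ₗ[k] V} {x y : V}

theorem bracket_fixedPoint_add (hZ : ∀ u v, Q.bracket (Z u) v = Z (Q.bracket u v))
    (hx : x ∈ Q.even) (hy : ∀ m, Z (Q.fixedPointDeriv x y m) ∈ Q.even)
    (hZZ : ∀ i j, Q.bracket (Z (Q.fixedPointDeriv x y i)) (Z (Q.fixedPointDeriv x y j)) = 0) :
    Q.series.bracket (Q.fixedPoint x + Z.compLeft ℕ (Q.fixedPointDeriv x y))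
        (Q.fixedPoint x + Z.compLeft ℕ (Q.fixedPointDeriv x y)) =
      Q.series.bracket (Q.fixedPoint x) (Q.fixedPoint x) +
        (2 : k) • Z.compLeft ℕ
          (Q.series.bracket (Q.fixedPointDeriv x y) (Q.fixedPoint x)) := by
  refine Q.series.bracket_add_self (fun u v => funext fun m => ?_) (Q.fixedPoint_mem hx)
    (Q.series_mem_even.2 hy) (funext fun m => ?_)
  · cases m with
    | zero => exact (Z.map_zero).symm
    | succ m =>
      rw [LinearMap.compLeft_apply, Function.comp_apply, series_bracket_succ,
        series_bracket_succ, map_sum]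
      exact Finset.sum_congr rfl fun ij _ => hZ _ _
  · cases m with
    | zero => rfl
    | succ m =>
      rw [series_bracket_succ]
      exact Finset.sum_eq_zero fun ij _ => hZZ _ _

theorem fixedPoint_add (hη : ∀ v, Q.η (Z v) = Z (Q.η v))
    (hZ : ∀ u v, Q.bracket (Z u) v = Z (Q.bracket u v)) (hx : x ∈ Q.even)
    (hy : ∀ m, Z (Q.fixedPointDeriv x y m) ∈ Q.even)
    (hZZ : ∀ i j, Q.bracket (Z (Q.fixedPointDeriv x y i)) (Z (Q.fixedPointDeriv x y j)) = 0) :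
    Q.fixedPoint (x + Z y) =
      Q.fixedPoint x + Z.compLeft ℕ (Q.fixedPointDeriv x y) := by
  have hηZ (u : ℕ → V) : Q.series.η (Z.compLeft ℕ u) = Z.compLeft ℕ (Q.series.η u) :=
    funext fun m => hη (u m)
  have hsingle : Z.compLeft ℕ (Pi.single 0 y) = Pi.single 0 (Z y) :=
    funext fun m => by
      cases m <;> simp only [LinearMap.compLeft_apply, Function.comp_apply, Pi.single_eq_same,
        Pi.single_eq_of_ne (Nat.succ_ne_zero _), map_zero]
  refine (Q.eq_fixedPoint ?_).symm
  rw [bracket_fixedPoint_add hZ hx hy hZZ, map_add, smul_add, map_smul, hηZ, smul_smul,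
    invOf_mul_self, one_smul, Pi.single_add]
  nth_rewrite 1 [fixedPoint_eq, fixedPointDeriv_eq]
  rw [map_add, hsingle]
  abel

theorem kuranishi_add (hη : ∀ v, Q.η (Z v) = Z (Q.η v))
    (hZ : ∀ u v, Q.bracket (Z u) v = Z (Q.bracket u v)) (hx : x ∈ Q.even)
    (hy : ∀ m, Z (Q.fixedPointDeriv x y m) ∈ Q.even)
    (hZZ : ∀ i j, Q.bracket (Z (Q.fixedPointDeriv x y i)) (Z (Q.fixedPointDeriv x y j)) = 0)
    (hproj : ∀ v, Q.proj (Z v) = Z (Q.proj v)) (m : ℕ) :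
    Q.kuranishi (x + Z y) m = Q.kuranishi x m + Z (Q.kuranishiDeriv x y m) := by
  rw [kuranishi, fixedPoint_add hη hZ hx hy hZZ, bracket_fixedPoint_add hZ hx hy hZZ, map_add,
    smul_add, map_smul, smul_smul, invOf_mul_self, one_smul, Pi.add_apply, series_proj_apply]
  exact congrArg (_ + ·) (hproj _)

end FirstOrder

end Kuranishi

end SplitOddLie

/-! ### Signs as scalars -/

/-- The sign `(-1)^n` as an element of a commutative ring. -/
def koszulSign (k : Type*) [CommRing k] (n : ℤ) : k := ((Int.negOnePow n : ℤ) : k)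

section koszulSign

variable {k : Type*} [CommRing k]

theorem koszulSign_add (a b : ℤ) : koszulSign k (a + b) = koszulSign k a * koszulSign k b := by
  simp [koszulSign, Int.negOnePow_add]

theorem koszulSign_congr {a b : ℤ} (h : Even a ↔ Even b) : koszulSign k a = koszulSign k b := by
  rw [koszulSign, koszulSign, (Int.negOnePow_eq_iff a b).2 (Int.even_sub.2 h)]

theorem koszulSign_zero : koszulSign k 0 = 1 := by simp [koszulSign]

theorem koszulSign_add_one (a : ℤ) : koszulSign k (a + 1) = -koszulSign k a := by
  simp [koszulSign, Int.negOnePow_add]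

theorem koszulSign_mul_self (a : ℤ) : koszulSign k a * koszulSign k a = 1 := by
  rw [← koszulSign_add, ← koszulSign_zero]
  exact koszulSign_congr (by simp)

theorem negOnePow_smul_eq {V : Type*} [AddCommGroup V] [Module k V] (n : ℤ) (v : V) :
    Int.negOnePow n • v = koszulSign k n • v := by
  rw [koszulSign, Int.cast_smul_eq_zsmul, Units.smul_def]

theorem intUnits_smul_eq (k : Type*) [CommRing k] {V : Type*} [AddCommGroup V] [Module k V]
    (u : ℤˣ) (v : V) : u • v = ((u : ℤ) : k) • v := by
  rw [Int.cast_smul_eq_zsmul, Units.smul_def]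

end koszulSign

/-! ### Products of square zero elements -/

/-- A family of elements of a `k`-algebra with degrees, closed under scaling and products, whose
members commute up to Koszul signs and have square zero. Sums are left out, as the sum of two
elements of even degree need not have square zero. -/
structure IsSquareZeroFamily (k : Type*) {R : Type*} [CommRing k] [Ring R] [Algebra k R]
    (M : ℤ → R → Prop) : Prop where
  smul : ∀ {a : ℤ} {r : R} (c : k), M a r → M a (c • r)
  mul : ∀ {a b : ℤ} {r s : R}, M a r → M b s → M (a + b) (r * s)
  comm : ∀ {a b : ℤ} {r s : R}, M a r → M b s → r * s = koszulSign k (a * b) • (s * r)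
  sq : ∀ {a : ℤ} {r : R}, M a r → r * r = 0

section koszulProd

variable (k : Type*) {R J : Type*} [CommRing k] [Ring R] [Algebra k R]

/-- The product of the `r x`, where `x` runs through a list, with the sign which turns the
commutation rule of elements of degree `1 - deg x` into that of the graded exterior algebra. -/
def koszulProd (deg : J → ℤ) (r : J → R) : List J → R
  | [] => 1
  | x :: w => koszulSign k (deg x * w.length) • (r x * koszulProd deg r w)

variable {k}
variable {M : ℤ → R → Prop} {deg : J → ℤ} {r : J → R}

theorem koszulProd_map {J' : Type*} (g : J' → J) (w : List J') :
    koszulProd k deg r (w.map g) = koszulProd k (deg ∘ g) (r ∘ g) w := by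
  induction w with
  | nil => rfl
  | cons x w ih => simp [koszulProd, ih]

theorem koszulProd_append (w w' : List J) :
    koszulProd k deg r (w ++ w') =
      koszulSign k ((w.map deg).sum * w'.length) •
        (koszulProd k deg r w * koszulProd k deg r w') := by
  induction w with
  | nil => simp [koszulProd, koszulSign_zero]
  | cons x w ih =>
    simp only [List.cons_append, koszulProd, ih, List.map_cons, List.sum_cons, mul_smul_comm,
      smul_mul_assoc, smul_smul, mul_assoc, ← koszulSign_add, List.length_append]
    congr 2
    push_cast
    ring

theorem koszulProd_mem (hM : IsSquareZeroFamily k M) (hr : ∀ x, M (1 - deg x) (r x)) (w : List J)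
    (hw : w ≠ []) : M ((w.map fun x => 1 - deg x).sum) (koszulProd k deg r w) := by
  induction w with
  | nil => exact absurd rfl hw
  | cons x w ih =>
    rw [koszulProd]
    refine hM.smul _ ?_
    by_cases h : w = []
    · subst h
      simpa [koszulProd] using hr x
    · simpa using hM.mul (hr x) (ih h)

theorem mul_koszulProd_eq_zero (hM : IsSquareZeroFamily k M) (hr : ∀ x, M (1 - deg x) (r x))
    {a : ℤ} {s : R} (hs : M a s) {x : J} (hx : s * r x = 0) (w : List J) (hw : x ∈ w) :
    s * koszulProd k deg r w = 0 := by
  induction w with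
  | nil => simp at hw
  | cons y w ih =>
    rw [koszulProd, mul_smul_comm, ← mul_assoc]
    rcases List.mem_cons.1 hw with rfl | h
    · rw [hx, zero_mul, smul_zero]
    · rw [hM.comm hs (hr y), smul_mul_assoc, mul_assoc, ih h, mul_zero, smul_zero, smul_zero]

theorem koszulProd_eq_zero (hM : IsSquareZeroFamily k M) (hr : ∀ x, M (1 - deg x) (r x))
    (w : List J) (hw : ¬ w.Pairwise fun x y => r x * r y ≠ 0) : koszulProd k deg r w = 0 := by
  induction w with
  | nil => simp at hw
  | cons x w ih =>
    rw [koszulProd]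
    rw [List.pairwise_cons, not_and_or] at hw
    rcases hw with hw | hw
    · push Not at hw
      obtain ⟨y, hy, h⟩ := hw
      rw [mul_koszulProd_eq_zero hM hr (hr x) h w hy, smul_zero]
    · rw [ih hw, mul_zero, smul_zero]

theorem koszulProd_ofFn_eq_zero (hM : IsSquareZeroFamily k M) (hr : ∀ x, M (1 - deg x) (r x))
    {n : ℕ} {f : Fin n → J} {i j : Fin n} (hij : i ≠ j) (h : r (f i) * r (f j) = 0) :
    koszulProd k deg r (List.ofFn f) = 0 := by
  refine koszulProd_eq_zero hM hr _ fun hw => ?_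
  rw [List.pairwise_ofFn] at hw
  rcases lt_or_gt_of_ne hij with h' | h'
  · exact hw h' h
  · refine hw h' ?_
    rw [hM.comm (hr _) (hr _), h, smul_zero]

theorem koszulProd_cons_cons (hM : IsSquareZeroFamily k M) (hr : ∀ x, M (1 - deg x) (r x)) (x y : J)
    (w : List J) : koszulProd k deg r (x :: y :: w) =
      (-koszulSign k (deg x * deg y)) • koszulProd k deg r (y :: x :: w) := by
  simp only [koszulProd, mul_smul_comm, smul_smul, ← mul_assoc]
  rw [hM.comm (hr x) (hr y), smul_mul_assoc, smul_smul, ← koszulSign_add_one]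
  simp only [← koszulSign_add]
  congr 1
  refine koszulSign_congr ?_
  grind [Int.even_add, Int.even_sub, Int.not_even_one]

variable [LinearOrder J]

/-- The Koszul sign of moving `x` to its place in the sorted list. -/
def insertSign (deg : J → ℤ) (x : J) (w : List J) : ℤˣ :=
  (w.map fun y => if y < x then -Int.negOnePow (deg x * deg y) else 1).prod

/-- The Koszul sign of sorting a list. -/
def sortSign (deg : J → ℤ) : List J → ℤˣ
  | [] => 1
  | x :: w => insertSign deg x w * sortSign deg w

theorem koszulProd_orderedInsert (hM : IsSquareZeroFamily k M) (hr : ∀ x, M (1 - deg x) (r x))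
    (x : J) (w : List J) (hw : w.Pairwise (· ≤ ·)) : koszulProd k deg r (x :: w) =
      ((insertSign deg x w : ℤ) : k) • koszulProd k deg r (w.orderedInsert (· ≤ ·) x) := by
  induction w with
  | nil => simp [insertSign]
  | cons y w ih =>
    rw [List.pairwise_cons] at hw
    by_cases h : x ≤ y
    · have insertSign_eq_one : insertSign deg x (y :: w) = 1 := by
        refine List.prod_eq_one fun u hu => ?_
        obtain ⟨z, hz, rfl⟩ := List.mem_map.1 hu
        refine if_neg (not_lt.2 ?_)
        rcases List.mem_cons.1 hz with rfl | hz
        · exact h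
        · exact h.trans (hw.1 z hz)
      rw [List.orderedInsert_cons_of_le _ _ h, insertSign_eq_one, Units.val_one, Int.cast_one,
        one_smul]
    · have insertSign_cons :
          insertSign deg x (y :: w) = -Int.negOnePow (deg x * deg y) * insertSign deg x w := by
        simp [insertSign, not_le.1 h]
      rw [List.orderedInsert_of_not_le _ _ h, koszulProd_cons_cons hM hr, koszulProd, ih hw.2,
        koszulProd, insertSign_cons]
      simp only [List.length_cons, List.orderedInsert_length, mul_smul_comm, smul_smul,
        Units.val_mul, Units.val_neg, Int.cast_mul, Int.cast_neg, koszulSign]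
      congr 1
      ring

theorem koszulProd_sort (hM : IsSquareZeroFamily k M) (hr : ∀ x, M (1 - deg x) (r x)) (w : List J) :
    koszulProd k deg r w =
      ((sortSign deg w : ℤ) : k) • koszulProd k deg r (w.insertionSort (· ≤ ·)) := by
  induction w with
  | nil => simp [sortSign]
  | cons x w ih =>
    have insertSign_sort : insertSign deg x (w.insertionSort (· ≤ ·)) = insertSign deg x w :=
      ((List.perm_insertionSort (· ≤ ·) w).map _).prod_eq
    calc koszulProd k deg r (x :: w)
        = ((sortSign deg w : ℤ) : k) • koszulProd k deg r (x :: w.insertionSort (· ≤ ·)) := by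
          rw [koszulProd, ih, koszulProd, List.length_insertionSort, mul_smul_comm, smul_comm]
      _ = _ := by
          rw [koszulProd_orderedInsert hM hr _ _ (List.pairwise_insertionSort _ _),
            insertSign_sort, smul_smul, sortSign, List.insertionSort_cons, Units.val_mul,
            Int.cast_mul, mul_comm]

theorem sortSign_ofFn {n : ℕ} (f : Fin n → J) : sortSign deg (List.ofFn f) =
    ∏ i : Fin n, ∏ j : Fin n,
      if i < j ∧ f j < f i then -Int.negOnePow (deg (f i) * deg (f j)) else 1 := by
  induction n with
  | zero => simp [sortSign]
  | succ n ih =>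
    rw [List.ofFn_succ, sortSign, ih, Fin.prod_univ_succ]
    congr 1
    · simp [insertSign, List.map_ofFn, List.prod_ofFn, Fin.prod_univ_succ]
    · simp [Fin.prod_univ_succ]

end koszulProd

theorem koszulProd_perm {k R : Type*} [CommRing k] [Ring R] [Algebra k R] {M : ℤ → R → Prop}
    {n : ℕ} {deg : Fin n → ℤ} {r : Fin n → R} (hM : IsSquareZeroFamily k M)
    (hr : ∀ x, M (1 - deg x) (r x)) (σ : Equiv.Perm (Fin n)) :
    koszulProd k deg r (List.ofFn σ) =
      ((koszulChi σ deg : ℤ) : k) • koszulProd k deg r (List.finRange n) := by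
  rw [koszulProd_sort hM hr, sortSign_ofFn]
  congr 2
  refine List.Perm.eq_of_pairwise (fun a b _ _ => le_antisymm) (List.pairwise_insertionSort _ _)
    (List.pairwise_le_finRange n) ((List.perm_insertionSort _ _).trans ?_)
  rw [← List.map_id (List.ofFn σ), ← List.ofFn_id, List.map_id]
  exact Equiv.Perm.ofFn_comp_perm σ id

/-! ### Extension of scalars to a square zero family -/

section Span

variable {k X Y Z W : Type*} [CommRing k] [AddCommGroup X] [Module k X] [AddCommGroup Y]
  [Module k Y] [AddCommGroup Z] [Module k Z] [AddCommGroup W] [Module k W]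

theorem bilinear_eqOn_span {s : Set X} {t : Set Y} {f g : X →ₗ[k] Y →ₗ[k] W}
    (h : ∀ x ∈ s, ∀ y ∈ t, f x y = g x y) :
    ∀ x ∈ Submodule.span k s, ∀ y ∈ Submodule.span k t, f x y = g x y := fun _ hx y hy =>
  LinearMap.eqOn_span (f := f.flip y) (g := g.flip y)
    (fun x hx => LinearMap.eqOn_span (f := f x) (g := g x) (h x hx) hy) hx

theorem trilinear_eqOn_span {s : Set X} {t : Set Y} {u : Set Z} {f g : X →ₗ[k] Y →ₗ[k] Z →ₗ[k] W}
    (h : ∀ x ∈ s, ∀ y ∈ t, ∀ z ∈ u, f x y z = g x y z) : ∀ x ∈ Submodule.span k s,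
    ∀ y ∈ Submodule.span k t, ∀ z ∈ Submodule.span k u, f x y z = g x y z := fun x hx y hy z hz =>
  bilinear_eqOn_span (f := f.compr₂ (LinearMap.applyₗ z)) (g := g.compr₂ (LinearMap.applyₗ z))
    (fun x hx y hy => LinearMap.eqOn_span (f := f x y) (g := g x y) (h x hx y hy) hz) x hx y hy

/-- The sum `[[x,y],z] + [[y,z],x] + [[z,x],y]`, as a trilinear map. -/
def jacobiator (B : X →ₗ[k] X →ₗ[k] X) : X →ₗ[k] X →ₗ[k] X →ₗ[k] X :=
  B.compr₂ B + (LinearMap.lflip.toLinearMap ∘ₗ B.compr₂ B).flip +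
    LinearMap.lflip.toLinearMap ∘ₗ (B.compr₂ B).flip

theorem jacobiator_apply (B : X →ₗ[k] X →ₗ[k] X) (x y z : X) :
    jacobiator B x y z = B (B x y) z + B (B y z) x + B (B z x) y := rfl

end Span

section Graded

variable {ι k L : Type*} [DecidableEq ι] [CommRing k] [AddCommGroup L] [Module k L]

theorem coeLinearMap_symm_of_mem {gr : ι → Submodule k L} (h : DirectSum.IsInternal gr) {i : ι}
    {u : L} (hu : u ∈ gr i) : (LinearEquiv.ofBijective (DirectSum.coeLinearMap gr) h).symm u =
      DirectSum.lof k ι (fun i => gr i) i ⟨u, hu⟩ := by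
  rw [LinearEquiv.symm_apply_eq]
  exact (DirectSum.coeLinearMap_lof gr i ⟨u, hu⟩).symm

/-- The linear operator which multiplies the elements of degree `i` by `(-1)^i`. -/
noncomputable def signOp {gr : ℤ → Submodule k L} (h : DirectSum.IsInternal gr) : L →ₗ[k] L :=
  DirectSum.toModule k ℤ L (fun i => koszulSign k i • (gr i).subtype) ∘ₗ
    (LinearEquiv.ofBijective (DirectSum.coeLinearMap gr) h).symm.toLinearMap

theorem signOp_apply {gr : ℤ → Submodule k L} (h : DirectSum.IsInternal gr) {i : ℤ} {u : L}
    (hu : u ∈ gr i) : signOp h u = koszulSign k i • u := by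
  rw [signOp, LinearMap.comp_apply, LinearEquiv.coe_coe, coeLinearMap_symm_of_mem h hu,
    DirectSum.toModule_lof]
  rfl

end Graded

section tensorBracket

variable {k L R : Type*} [CommRing k] [AddCommGroup L] [Module k L] [Ring R] [Algebra k R]
  {M : ℤ → R → Prop}

/-- The elements of total degree `m` in `R ⊗ L`, the first factor being graded by `M`. -/
def totalDegree (M : ℤ → R → Prop) (gr : ℤ → Submodule k L) (m : ℤ) : Submodule k (R ⊗[k] L) :=
  Submodule.span k {v | ∃ i r u, M (m - i) r ∧ u ∈ gr i ∧ v = r ⊗ₜ[k] u}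

theorem tmul_mem_totalDegree {gr : ℤ → Submodule k L} {m a i : ℤ} {r : R}
    {u : L} (hr : M a r) (hu : u ∈ gr i) (h : a + i = m) :
    r ⊗ₜ[k] u ∈ totalDegree M gr m := by
  refine Submodule.subset_span ⟨i, r, u, ?_, hu, rfl⟩
  rwa [← h, add_sub_cancel_right]

variable (R) (A : DGLieAlgebra k L)

/-- The `R`-bilinear extension `(r ⊗ u, s ⊗ v) ↦ (-1)^{|u|} rs ⊗ [u,v]` of the bracket of the
desuspension of `A`. -/
noncomputable def tensorBracket : R ⊗[k] L →ₗ[k] R ⊗[k] L →ₗ[k] R ⊗[k] L :=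
  TensorProduct.map₂ (LinearMap.mul k R) (A.bracket ∘ₗ signOp A.isInternal)

variable {R A}

theorem tensorBracket_tmul {i : ℤ} {u : L} (hu : u ∈ A.gr i) (r s : R) (v : L) :
    tensorBracket R A (r ⊗ₜ u) (s ⊗ₜ v) = koszulSign k i • ((r * s) ⊗ₜ A.bracket u v) := by
  rw [tensorBracket, TensorProduct.map₂_apply_tmul, LinearMap.comp_apply,
    signOp_apply A.isInternal hu, map_smul, TensorProduct.map_tmul, LinearMap.smul_apply,
    TensorProduct.tmul_smul]
  rfl

theorem tensorBracket_rTensor_mulLeft (s : R) (x y : R ⊗[k] L) :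
    tensorBracket R A ((LinearMap.mulLeft k s).rTensor L x) y =
      (LinearMap.mulLeft k s).rTensor L (tensorBracket R A x y) := by
  induction x with
  | zero => simp only [map_zero, LinearMap.zero_apply]
  | add x x' h h' => simp only [map_add, LinearMap.add_apply, h, h']
  | tmul r u =>
    induction y with
    | zero => simp only [map_zero]
    | add y y' h h' => simp only [map_add, h, h']
    | tmul r' u' => simp [tensorBracket, mul_assoc]

theorem tensorBracket_mem (hM : IsSquareZeroFamily k M) {m n : ℤ} {x y : R ⊗[k] L}
    (hx : x ∈ totalDegree M A.gr m) (hy : y ∈ totalDegree M A.gr n) :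
    tensorBracket R A x y ∈ totalDegree M A.gr (m + n) := by
  suffices h : Submodule.map₂ (tensorBracket R A) (totalDegree M A.gr m) (totalDegree M A.gr n) ≤
      totalDegree M A.gr (m + n) from h (Submodule.apply_mem_map₂ _ hx hy)
  rw [totalDegree, totalDegree, Submodule.map₂_span_span, Submodule.span_le]
  rintro _ ⟨_, ⟨i, r, u, hr, hu, rfl⟩, _, ⟨j, s, v, hs, hv, rfl⟩, rfl⟩
  dsimp only
  rw [SetLike.mem_coe, tensorBracket_tmul hu]
  exact Submodule.smul_mem _ _ (tmul_mem_totalDegree (hM.mul hr hs)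
    (A.bracket_mem _ _ _ _ hu hv) (by ring))

theorem lTensor_eta_mem {η : L →ₗ[k] L} (hη : A.IsSplitting η) {m n : ℤ} (h : m = n + 1)
    {x : R ⊗[k] L} (hx : x ∈ totalDegree M A.gr m) : η.lTensor R x ∈ totalDegree M A.gr n := by
  suffices h : (totalDegree M A.gr m).map (η.lTensor R) ≤ totalDegree M A.gr n from
    h (Submodule.mem_map_of_mem hx)
  rw [totalDegree, Submodule.map_span_le]
  rintro _ ⟨i, r, u, hr, hu, rfl⟩
  exact tmul_mem_totalDegree hr (hη.eta_mem i u hu) (by omega)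

theorem tensorBracket_symm (hM : IsSquareZeroFamily k M) : ∀ x ∈ totalDegree M A.gr 1,
    ∀ y ∈ totalDegree M A.gr 1, tensorBracket R A x y = tensorBracket R A y x := by
  refine bilinear_eqOn_span (g := (tensorBracket R A).flip) ?_
  rintro _ ⟨i, r, u, hr, hu, rfl⟩ _ ⟨j, s, v, hs, hv, rfl⟩
  rw [LinearMap.flip_apply, tensorBracket_tmul hu, tensorBracket_tmul hv, hM.comm hr hs,
    A.bracket_antisymm i j u v hu hv, negOnePow_smul_eq (k := k), ← neg_smul,
    TensorProduct.tmul_smul, ← TensorProduct.smul_tmul', smul_smul, smul_smul,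
    ← koszulSign_add_one, ← koszulSign_add, ← koszulSign_add]
  congr 1
  refine koszulSign_congr ?_
  grind [Int.even_add, Int.even_sub, Int.not_even_one]

theorem bracket_jacobi_cyclic {i j l : ℤ} {u v w : L} (hu : u ∈ A.gr i) (hv : v ∈ A.gr j)
    (hw : w ∈ A.gr l) : koszulSign k (i * l) • A.bracket (A.bracket u v) w +
      koszulSign k (i * j) • A.bracket (A.bracket v w) u +
      koszulSign k (j * l) • A.bracket (A.bracket w u) v = 0 := by
  have swap {a b : ℤ} {x y : L} (hx : x ∈ A.gr a) (hy : y ∈ A.gr b) :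
      A.bracket x y = koszulSign k (a * b + 1) • A.bracket y x := by
    rw [A.bracket_antisymm _ _ _ _ hx hy, negOnePow_smul_eq (k := k), ← neg_smul,
      ← koszulSign_add_one]
  have jacobi := A.bracket_jacobi _ _ _ _ _ _ hu hv hw
  rw [negOnePow_smul_eq (k := k)] at jacobi
  rw [swap (A.bracket_mem _ _ _ _ hv hw) hu, swap hw hu, map_smul, LinearMap.smul_apply,
    swap (A.bracket_mem _ _ _ _ hu hw) hv, jacobi]
  simp only [smul_add, smul_smul, ← koszulSign_add]
  have sign₁ : koszulSign k (i * j + ((j + l) * i + 1)) = -koszulSign k (i * l) := by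
    rw [← koszulSign_add_one]
    exact koszulSign_congr (by grind [Int.even_add, Int.not_even_one])
  have sign₂ : koszulSign k (i * j + ((j + l) * i + 1 + i * j)) =
      -koszulSign k (i * l + i * j) := by
    rw [← koszulSign_add_one]
    exact koszulSign_congr (by grind [Int.even_add, Int.not_even_one])
  have sign₃ : koszulSign k (j * l + (l * i + 1 + ((i + l) * j + 1))) =
      koszulSign k (i * l + i * j) :=
    koszulSign_congr (by grind [Int.even_add, Int.not_even_one])
  rw [← add_assoc, sign₁, sign₂, sign₃]
  module

theorem tensorBracket_jacobi (hM : IsSquareZeroFamily k M) : ∀ x ∈ totalDegree M A.gr 1,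
    ∀ y ∈ totalDegree M A.gr 1, ∀ z ∈ totalDegree M A.gr 1,
    jacobiator (tensorBracket R A) x y z = 0 := by
  refine trilinear_eqOn_span (g := 0) ?_
  rintro _ ⟨i, r, u, hr, hu, rfl⟩ _ ⟨j, s, v, hs, hv, rfl⟩ _ ⟨l, t, w, ht, hw, rfl⟩
  have str : s * t * r = koszulSign k ((1 - j + (1 - l)) * (1 - i)) • (r * s * t) := by
    rw [hM.comm (hM.mul hs ht) hr, mul_assoc]
  have trs : t * r * s = koszulSign k ((1 - l) * (1 - i + (1 - j))) • (r * s * t) := by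
    rw [mul_assoc, hM.comm ht (hM.mul hr hs)]
  have sign₁ : koszulSign k (i + (i + j)) = koszulSign k (j + i * l + i * l) :=
    koszulSign_congr (by grind [Int.even_add])
  have sign₂ : koszulSign k (j + (j + l + (1 - j + (1 - l)) * (1 - i))) =
      koszulSign k (j + i * l + i * j) :=
    koszulSign_congr (by grind [Int.even_add, Int.even_sub, Int.not_even_one])
  have sign₃ : koszulSign k (l + (l + i + (1 - l) * (1 - i + (1 - j)))) =
      koszulSign k (j + i * l + j * l) :=
    koszulSign_congr (by grind [Int.even_add, Int.even_sub, Int.not_even_one])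
  calc jacobiator (tensorBracket R A) (r ⊗ₜ u) (s ⊗ₜ v) (t ⊗ₜ w)
      = koszulSign k (j + i * l) • ((r * s * t) ⊗ₜ[k]
          (koszulSign k (i * l) • A.bracket (A.bracket u v) w +
            koszulSign k (i * j) • A.bracket (A.bracket v w) u +
            koszulSign k (j * l) • A.bracket (A.bracket w u) v)) := by
        rw [jacobiator_apply, tensorBracket_tmul hu, tensorBracket_tmul hv, tensorBracket_tmul hw]
        simp only [map_smul, LinearMap.smul_apply]
        rw [tensorBracket_tmul (A.bracket_mem _ _ _ _ hu hv),
          tensorBracket_tmul (A.bracket_mem _ _ _ _ hv hw),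
          tensorBracket_tmul (A.bracket_mem _ _ _ _ hw hu), str, trs]
        simp only [TensorProduct.tmul_add, TensorProduct.tmul_smul, ← TensorProduct.smul_tmul',
          smul_add, smul_smul, ← koszulSign_add, sign₁, sign₂, sign₃]
    _ = 0 := by rw [bracket_jacobi_cyclic hu hv hw, TensorProduct.tmul_zero, smul_zero]

theorem tensorBracket_cubic (hM : IsSquareZeroFamily k M) : ∀ x ∈ totalDegree M A.gr 1,
    tensorBracket R A (tensorBracket R A x x) x = 0 := by
  intro x hx
  induction hx using Submodule.span_induction with
  | mem x hx =>
    obtain ⟨i, r, u, hr, hu, rfl⟩ := hx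
    rw [tensorBracket_tmul hu, hM.sq hr, TensorProduct.zero_tmul, smul_zero, map_zero,
      LinearMap.zero_apply]
  | zero => simp only [map_zero]
  | smul c x _ h => simp only [map_smul, LinearMap.smul_apply, h, smul_zero]
  | add x y hx hy h₁ h₂ =>
    have hxy := tensorBracket_symm hM x hx y hy
    have j₁ := tensorBracket_jacobi hM x hx x hx y hy
    have j₂ := tensorBracket_jacobi hM y hy y hy x hx
    rw [jacobiator_apply, ← hxy] at j₁ j₂
    simp only [map_add, LinearMap.add_apply, ← hxy, h₁, h₂, zero_add, add_zero]
    rw [← add_zero (0 : R ⊗[k] L)]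
    nth_rewrite 1 [← j₁]
    rw [← j₂]
    abel

theorem d_tensorBracket (hM : IsSquareZeroFamily k M) : ∀ x ∈ totalDegree M A.gr 1,
    ∀ y ∈ totalDegree M A.gr 1, A.d.lTensor R (tensorBracket R A x y) =
      -tensorBracket R A (A.d.lTensor R x) y - tensorBracket R A (A.d.lTensor R y) x := by
  suffices h : ∀ x ∈ totalDegree M A.gr 1, ∀ y ∈ totalDegree M A.gr 1,
      ((tensorBracket R A).compr₂ (A.d.lTensor R) + (tensorBracket R A ∘ₗ A.d.lTensor R).flip +
        tensorBracket R A ∘ₗ A.d.lTensor R) x y = 0 from fun x hx y hy =>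
    eq_sub_of_add_eq (eq_neg_of_add_eq_zero_left (h x hx y hy))
  refine bilinear_eqOn_span (g := 0) ?_
  rintro _ ⟨i, r, u, hr, hu, rfl⟩ _ ⟨j, s, v, hs, hv, rfl⟩
  have hdv := A.d_mem _ _ hv
  have sign : koszulSign k (j + 1 + ((j + 1) * i + 1 + (1 - j) * (1 - i))) = -1 := by
    rw [← koszulSign_zero (k := k), ← koszulSign_add_one]
    exact koszulSign_congr (by grind [Int.even_add, Int.even_sub, Int.not_even_one])
  simp only [LinearMap.add_apply, LinearMap.compr₂_apply, LinearMap.flip_apply,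
    LinearMap.comp_apply, LinearMap.zero_apply]
  rw [tensorBracket_tmul hu, map_smul, LinearMap.lTensor_tmul, LinearMap.lTensor_tmul,
    LinearMap.lTensor_tmul, tensorBracket_tmul (A.d_mem _ _ hu), tensorBracket_tmul hdv,
    A.d_bracket i u v hu, A.bracket_antisymm _ _ _ _ hdv hu, hM.comm hs hr,
    negOnePow_smul_eq (k := k), negOnePow_smul_eq (k := k), ← neg_smul, ← koszulSign_add_one]
  simp only [TensorProduct.tmul_add, TensorProduct.tmul_smul, ← TensorProduct.smul_tmul',
    smul_add, smul_smul, ← koszulSign_add, sign]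
  rw [koszulSign_add_one, koszulSign_add, koszulSign_mul_self]
  module

/-- The odd Lie bracket on `R ⊗ L`, whose even elements are those of total degree `1`. -/
noncomputable def tensorOddLie (hM : IsSquareZeroFamily k M) {η : L →ₗ[k] L}
    (hη : A.IsSplitting η) : SplitOddLie k (R ⊗[k] L) where
  d := A.d.lTensor R
  η := η.lTensor R
  bracket := tensorBracket R A
  even := totalDegree M A.gr 1
  d_d v := by
    have h : A.d ∘ₗ A.d = 0 := LinearMap.ext A.d_d
    rw [← LinearMap.lTensor_comp_apply, h, LinearMap.lTensor_zero, LinearMap.zero_apply]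
  d_eta_d v := by
    have h : (A.d ∘ₗ η) ∘ₗ A.d = A.d := LinearMap.ext hη.d_eta_d
    rw [← LinearMap.lTensor_comp_apply, ← LinearMap.lTensor_comp_apply, h]
  eta_bracket_mem _ hx _ hy := lTensor_eta_mem hη (by norm_num) (tensorBracket_mem hM hx hy)
  symm := tensorBracket_symm hM
  jacobi := tensorBracket_jacobi hM
  cubic := tensorBracket_cubic hM
  d_bracket := d_tensorBracket hM

theorem tensorOddLie_proj (hM : IsSquareZeroFamily k M) {η : L →ₗ[k] L} (hη : A.IsSplitting η) :
    (tensorOddLie (R := R) hM hη).proj = (LinearMap.id - A.comm η).lTensor R := by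
  rw [SplitOddLie.proj, DGLieAlgebra.comm, LinearMap.lTensor_sub, LinearMap.lTensor_add,
    LinearMap.lTensor_comp, LinearMap.lTensor_comp, LinearMap.lTensor_id]
  rfl

theorem fixedPointDeriv_mem_totalDegree [Invertible (2 : k)] (hM : IsSquareZeroFamily k M)
    {η : L →ₗ[k] L} (hη : A.IsSplitting η) {x y : R ⊗[k] L} (hx : x ∈ totalDegree M A.gr 1)
    {n : ℤ} (hy : y ∈ totalDegree M A.gr n) (m : ℕ) :
    (tensorOddLie hM hη).fixedPointDeriv x y m ∈ totalDegree M A.gr n := by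
  induction m using Nat.strong_induction_on with
  | _ m ih =>
    cases m with
    | zero => rwa [SplitOddLie.fixedPointDeriv_zero]
    | succ m =>
      rw [SplitOddLie.fixedPointDeriv_succ, SplitOddLie.series_bracket_succ, map_sum]
      refine Submodule.sum_mem _ fun ij h => ?_
      exact lTensor_eta_mem hη rfl (tensorBracket_mem hM
        (ih _ (by have := mem_antidiagonal.1 h; omega))
        ((tensorOddLie hM hη).series_mem_even.1 ((tensorOddLie hM hη).fixedPoint_mem hx) _))

end tensorBracket

/-! ### Sums over plane binary trees -/

theorem sum_treesOfNumNodesEq_succ {V : Type*} [AddCommMonoid V] (G : BinaryTree Unit → V)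
    (m : ℕ) : ∑ φ ∈ BinaryTree.treesOfNumNodesEq (m + 1), G φ =
      ∑ ij ∈ antidiagonal m, ∑ l ∈ BinaryTree.treesOfNumNodesEq ij.1,
        ∑ r ∈ BinaryTree.treesOfNumNodesEq ij.2, G (.node () l r) := by
  rw [BinaryTree.treesOfNumNodesEq_succ, Finset.sum_biUnion]
  · refine Finset.sum_congr rfl fun ij _ => ?_
    rw [BinaryTree.pairwiseNode, Finset.sum_map, Finset.sum_product]
    rfl
  · simp_rw [Set.PairwiseDisjoint, Set.Pairwise, Finset.disjoint_left]
    aesop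

theorem numNodes_of_mem_Ot {m : ℕ} (φ : Ot (m + 1)) : φ.1.numNodes = m :=
  Nat.succ_injective (φ.1.numLeaves_eq_numNodes_succ.symm.trans φ.2)

theorem sum_treesOfNumNodesEq_eq_sum_Ot {V : Type*} [AddCommMonoid V] (G : BinaryTree Unit → V)
    (m : ℕ) : ∑ φ ∈ BinaryTree.treesOfNumNodesEq m, G φ = ∑ φ : Ot (m + 1), G φ.1 :=
  Finset.sum_subtype _ (fun φ => by
    rw [BinaryTree.mem_treesOfNumNodesEq, φ.numLeaves_eq_numNodes_succ, Nat.succ_inj]) _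

namespace SplitOddLie

variable {k V : Type*} [CommRing k] [AddCommGroup V] [Module k V] (Q : SplitOddLie k V)

/-- The iterated brackets `η[·,·]` along a tree, all leaves being `x`. -/
def treeValue (x : V) : BinaryTree Unit → V
  | .nil => x
  | .node _ l r => Q.η (Q.bracket (treeValue x l) (treeValue x r))

/-- The iterated brackets along a tree, all leaves being `x`, with `f[·,·]` at the root and
`η[·,·]` at the other ramifications; the value `0` at the tree without ramifications is
arbitrary. -/
def rootedTreeValue (f : V →ₗ[k] V) (x : V) : BinaryTree Unit → V
  | .nil => 0
  | .node _ l r => f (Q.bracket (Q.treeValue x l) (Q.treeValue x r))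

variable [Invertible (2 : k)] {Q} {x : V}

theorem sum_rootedTreeValue (f : V →ₗ[k] V) {t : ℕ → V} {m : ℕ}
    (ht : ∀ i ≤ m, t i = ⅟(2 : k) ^ i • ∑ φ ∈ BinaryTree.treesOfNumNodesEq i, Q.treeValue x φ) :
    ⅟(2 : k) • f (Q.series.bracket t t (m + 1)) = ⅟(2 : k) ^ (m + 1) •
      ∑ φ ∈ BinaryTree.treesOfNumNodesEq (m + 1), Q.rootedTreeValue f x φ := by
  rw [series_bracket_succ, sum_treesOfNumNodesEq_succ, pow_succ', mul_smul, map_sum]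
  congr 1
  rw [Finset.smul_sum]
  refine Finset.sum_congr rfl fun ij h => ?_
  have h' := mem_antidiagonal.1 h
  rw [ht _ (by omega), ht _ (by omega), ← h', pow_add]
  simp only [rootedTreeValue, map_smul, map_sum, LinearMap.smul_apply, LinearMap.sum_apply]
  rw [← Finset.smul_sum, smul_smul, mul_comm, Finset.sum_comm]

theorem fixedPoint_eq_sum_treeValue (m : ℕ) : Q.fixedPoint x m =
    ⅟(2 : k) ^ m • ∑ φ ∈ BinaryTree.treesOfNumNodesEq m, Q.treeValue x φ := by
  induction m using Nat.strong_induction_on with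
  | _ m ih =>
    cases m with
    | zero => simp [fixedPoint_zero, treeValue]
    | succ m =>
      rw [fixedPoint_succ, sum_rootedTreeValue Q.η fun i hi => ih i (Nat.lt_succ_of_le hi),
        sum_treesOfNumNodesEq_succ, sum_treesOfNumNodesEq_succ]
      rfl

theorem kuranishi_eq_sum_rootedTreeValue (m : ℕ) : Q.kuranishi x (m + 1) = ⅟(2 : k) ^ (m + 1) •
    ∑ φ ∈ BinaryTree.treesOfNumNodesEq (m + 1), Q.rootedTreeValue Q.proj x φ := by
  rw [kuranishi_succ, sum_rootedTreeValue Q.proj fun i _ => fixedPoint_eq_sum_treeValue i]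

end SplitOddLie

/-! ### The sign of a tree -/

theorem length_ramificationsBefore (φ : BinaryTree Unit) :
    (ramificationsBefore φ).length = φ.numLeaves := by
  induction φ with
  | nil => rfl
  | node _ l r hl hr => simp [ramificationsBefore, BinaryTree.numLeaves, hl, hr]

theorem sum_zipIdx_map_sub (w : List ℕ) (c m m' : ℕ) :
    (((w.map fun s => s + c).zipIdx m).map fun p => (p.1 : ℤ) - (p.2 : ℤ)).sum =
      (((w.zipIdx m').map fun p => (p.1 : ℤ) - (p.2 : ℤ)).sum) +
        ((c : ℤ) - m + m') * w.length := by
  induction w generalizing m m' with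
  | nil => simp
  | cons a w ih =>
    simp only [List.map_cons, List.zipIdx_cons, List.sum_cons, ih (m + 1) (m' + 1),
      List.length_cons]
    push_cast
    ring

theorem treeSign_node (u : Unit) (l r : BinaryTree Unit) :
    treeSign (.node u l r) = treeSign l * treeSign r * Int.negOnePow l.numLeaves := by
  rw [treeSign, treeSign, treeSign, ← Int.negOnePow_add, ← Int.negOnePow_add]
  congr 1
  rw [ramificationsBefore, List.zipIdx_append, List.map_append, List.sum_append,
    sum_zipIdx_map_sub _ _ _ 0, sum_zipIdx_map_sub _ _ _ 0]
  simp only [List.length_map, length_ramificationsBefore, l.numLeaves_eq_numNodes_succ]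
  push_cast
  ring

/-- The sign `e(φ)`, corrected by the sign of moving the odd maps at the ramifications of `φ` out
of the tree. -/
def shiftedTreeSign (k : Type*) [CommRing k] (φ : BinaryTree Unit) : k :=
  koszulSign k φ.numNodes * ((treeSign φ : ℤ) : k)

theorem shiftedTreeSign_node {k : Type*} [CommRing k] (u : Unit) (l r : BinaryTree Unit) :
    shiftedTreeSign k (.node u l r) =
      koszulSign k l.numNodes * (shiftedTreeSign k l * shiftedTreeSign k r) := by
  have sign : koszulSign k ((BinaryTree.node u l r).numNodes : ℤ) * koszulSign k l.numLeaves =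
      koszulSign k l.numNodes * (koszulSign k l.numNodes * koszulSign k r.numNodes) := by
    simp only [← koszulSign_add, BinaryTree.numNodes, l.numLeaves_eq_numNodes_succ]
    push_cast
    exact koszulSign_congr (by grind [Int.even_add, Int.not_even_one])
  rw [shiftedTreeSign, shiftedTreeSign, shiftedTreeSign, treeSign_node, Units.val_mul,
    Units.val_mul, Int.cast_mul, Int.cast_mul]
  calc _ = koszulSign k ((BinaryTree.node u l r).numNodes : ℤ) * koszulSign k l.numLeaves *
        (((treeSign l : ℤ) : k) * ((treeSign r : ℤ) : k)) := by rw [koszulSign, koszulSign]; ring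
    _ = _ := by rw [sign]; ring

/-! ### Evaluation of trees on a generic element -/

section treeEval

variable {k L : Type*} [CommRing k] [AddCommGroup L] [Module k L]

theorem treeEval_mem {gr : ℤ → Submodule k L} (Ψ : BinaryTree (HomogeneousBilin gr))
    (deg : Fin Ψ.numLeaves → ℤ) (a : Fin Ψ.numLeaves → L) (ha : ∀ i, a i ∈ gr (deg i)) :
    treeEval Ψ deg a ∈ gr (∑ i, deg i + treeDegree Ψ) := by
  induction Ψ with
  | nil =>
    have sum_deg : ∑ i, deg i = deg (0 : Fin 1) := Fin.sum_univ_one deg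
    rw [treeDegree, add_zero, sum_deg]
    exact ha _
  | node b l r hl hr =>
    have sum_deg : ∑ i, deg i = ∑ i, deg (Fin.castAdd r.numLeaves i) +
        ∑ i, deg (Fin.natAdd l.numLeaves i) := Fin.sum_univ_add deg
    have total : ∑ i, deg i + treeDegree (.node b l r) =
        (∑ i, deg (Fin.castAdd r.numLeaves i) + treeDegree l) +
          (∑ i, deg (Fin.natAdd l.numLeaves i) + treeDegree r) + b.deg := by
      rw [treeDegree, sum_deg]
      ring
    rw [treeEval, negOnePow_smul_eq (k := k), total]
    exact Submodule.smul_mem _ _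
      (b.map_mem _ _ _ _ (hl _ _ fun i => ha _) (hr _ _ fun i => ha _))

theorem treeDegree_map_g {A : DGLieAlgebra k L} {η : L →ₗ[k] L} (hη : A.IsSplitting η)
    (φ : BinaryTree Unit) : treeDegree (φ.map fun _ => hη.g) = -(φ.numNodes : ℤ) := by
  induction φ with
  | nil => rfl
  | node u l r hl hr =>
    rw [BinaryTree.map, treeDegree, hl, hr, BinaryTree.numNodes]
    push_cast
    simp only [DGLieAlgebra.IsSplitting.g]
    ring

variable {R J : Type*} [Ring R] [Algebra k R] [Fintype J] {A : DGLieAlgebra k L}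
  {η : L →ₗ[k] L}

/-- The value of a tree on the generic element `∑ j, r j ⊗ b j`, up to a sign, expanded over
the labellings of the leaves by `J`. -/
noncomputable def genericTreeEval (deg : J → ℤ) (r : J → R) (b : J → L)
    (Ψ : BinaryTree (HomogeneousBilin A.gr)) : R ⊗[k] L :=
  ∑ f : Fin Ψ.numLeaves → J, koszulProd k deg r (List.ofFn f) ⊗ₜ[k]
    treeEval Ψ (fun i => deg (f i)) (fun i => b (f i))

variable {deg : J → ℤ} {r : J → R} {b : J → L}

theorem genericTreeEval_nil :
    genericTreeEval deg r b (.nil : BinaryTree (HomogeneousBilin A.gr)) =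
      ∑ j, r j ⊗ₜ[k] b j := by
  refine (Equiv.sum_comp (Equiv.funUnique (Fin 1) J).symm _).symm.trans ?_
  refine Finset.sum_congr rfl fun j _ => ?_
  have prod_singleton : koszulProd k deg r [j] = r j := by
    simp [koszulProd, koszulSign_zero]
  exact congrArg (· ⊗ₜ[k] b j) prod_singleton

theorem genericTreeEval_of_numLeaves_eq (Ψ : BinaryTree (HomogeneousBilin A.gr)) {n : ℕ}
    (h : Ψ.numLeaves = n) : genericTreeEval deg r b Ψ =
      ∑ f : Fin n → J, koszulProd k deg r (List.ofFn f) ⊗ₜ[k]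
        treeEval Ψ (fun i => deg (f (Fin.cast h i))) (fun i => b (f (Fin.cast h i))) := by
  subst h
  rfl

theorem lTensor_tensorBracket_genericTreeEval (hb : ∀ j, b j ∈ A.gr (deg j))
    {b₀ : HomogeneousBilin A.gr} {h : L →ₗ[k] L} (hb₀ : b₀.map = A.bracket.compr₂ h)
    (Ψ₁ : BinaryTree (HomogeneousBilin A.gr)) {Ψ₂ : BinaryTree (HomogeneousBilin A.gr)}
    (hΨ₂ : treeDegree Ψ₂ = 1 - Ψ₂.numLeaves) :
    h.lTensor R (tensorBracket R A (genericTreeEval deg r b Ψ₁) (genericTreeEval deg r b Ψ₂)) =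
      koszulSign k (treeDegree Ψ₁) • genericTreeEval deg r b (.node b₀ Ψ₁ Ψ₂) := by
  have reindex := Equiv.sum_comp (Fin.appendEquiv Ψ₁.numLeaves Ψ₂.numLeaves)
    fun f : Fin (Ψ₁.numLeaves + Ψ₂.numLeaves) → J => koszulProd k deg r (List.ofFn f) ⊗ₜ[k]
      treeEval (.node b₀ Ψ₁ Ψ₂) (fun i => deg (f i)) (fun i => b (f i))
  refine Eq.trans ?_ (congrArg (koszulSign k (treeDegree Ψ₁) • ·) reindex)
  simp only [genericTreeEval, Fintype.sum_prod_type, map_sum, LinearMap.sum_apply,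
    Finset.smul_sum]
  rw [Finset.sum_comm]
  refine Finset.sum_congr rfl fun f₁ _ => Finset.sum_congr rfl fun f₂ _ => ?_
  have prod_append : koszulProd k deg r (List.ofFn (Fin.append f₁ f₂)) =
      koszulSign k ((∑ i, deg (f₁ i)) * Ψ₂.numLeaves) •
        (koszulProd k deg r (List.ofFn f₁) * koszulProd k deg r (List.ofFn f₂)) := by
    rw [List.ofFn_fin_append, koszulProd_append, List.map_ofFn, List.sum_ofFn, List.length_ofFn]
    rfl
  rw [tensorBracket_tmul (treeEval_mem Ψ₁ _ _ fun i => hb _), map_smul, LinearMap.lTensor_tmul]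
  simp only [Fin.appendEquiv, Equiv.coe_fn_mk, treeEval, Fin.append_left, Fin.append_right, hb₀,
    LinearMap.compr₂_apply]
  rw [prod_append, negOnePow_smul_eq (k := k), TensorProduct.tmul_smul,
    ← TensorProduct.smul_tmul', smul_smul, smul_smul, hΨ₂, ← koszulSign_add, ← koszulSign_add]
  congr 1
  generalize (Ψ₂.numLeaves : ℤ) = q, treeDegree Ψ₁ = p, ∑ i, deg (f₁ i) = s
  exact koszulSign_congr (by grind [Int.even_add, Int.even_sub, Int.not_even_one])

variable {M : ℤ → R → Prop}

theorem treeDegree_map_g_eq (hη : A.IsSplitting η) (φ : BinaryTree Unit) :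
    treeDegree (φ.map fun _ => hη.g) = 1 - (φ.map fun _ => hη.g).numLeaves := by
  rw [treeDegree_map_g, numLeaves_map_const, φ.numLeaves_eq_numNodes_succ]
  push_cast
  ring

theorem lTensor_bracket_treeValue (hM : IsSquareZeroFamily k M) (hη : A.IsSplitting η)
    (hb : ∀ j, b j ∈ A.gr (deg j)) {b₀ : HomogeneousBilin A.gr} {h : L →ₗ[k] L}
    (hb₀ : b₀.map = A.bracket.compr₂ h) (φ₁ φ₂ : BinaryTree Unit) {x y : R ⊗[k] L}
    (hx : x = shiftedTreeSign k φ₁ • genericTreeEval deg r b (φ₁.map fun _ => hη.g))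
    (hy : y = shiftedTreeSign k φ₂ • genericTreeEval deg r b (φ₂.map fun _ => hη.g)) :
    h.lTensor R ((tensorOddLie hM hη).bracket x y) = shiftedTreeSign k (.node () φ₁ φ₂) •
      genericTreeEval deg r b (decorate b₀ hη.g (.node () φ₁ φ₂)) := by
  have sign : koszulSign k (-(φ₁.numNodes : ℤ)) = koszulSign k φ₁.numNodes :=
    koszulSign_congr even_neg
  change h.lTensor R (tensorBracket R A x y) = _
  rw [hx, hy, LinearMap.map_smul₂, map_smul, map_smul, map_smul,
    lTensor_tensorBracket_genericTreeEval hb hb₀ _ (treeDegree_map_g_eq hη φ₂),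
    treeDegree_map_g, sign, smul_smul, smul_smul, shiftedTreeSign_node]
  congr 1
  ring

theorem treeValue_eq_genericTreeEval (hM : IsSquareZeroFamily k M) (hη : A.IsSplitting η)
    (hb : ∀ j, b j ∈ A.gr (deg j)) (φ : BinaryTree Unit) :
    (tensorOddLie hM hη).treeValue (∑ j, r j ⊗ₜ[k] b j) φ =
      shiftedTreeSign k φ • genericTreeEval deg r b (φ.map fun _ => hη.g) := by
  induction φ with
  | nil =>
    have sign : shiftedTreeSign k (.nil : BinaryTree Unit) = 1 := by
      simp [shiftedTreeSign, treeSign, ramificationsBefore, koszulSign_zero]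
    rw [sign, one_smul]
    exact genericTreeEval_nil.symm
  | node _ φ₁ φ₂ h₁ h₂ => exact lTensor_bracket_treeValue (b₀ := hη.g) hM hη hb rfl φ₁ φ₂ h₁ h₂

theorem rootedTreeValue_eq_genericTreeEval (hM : IsSquareZeroFamily k M) (hη : A.IsSplitting η)
    (hb : ∀ j, b j ∈ A.gr (deg j)) {φ : BinaryTree Unit} (hφ : φ.numNodes ≠ 0) :
    (tensorOddLie hM hη).rootedTreeValue (tensorOddLie hM hη).proj (∑ j, r j ⊗ₜ[k] b j) φ =
      shiftedTreeSign k φ • genericTreeEval deg r b (decorate hη.projBracket hη.g φ) := by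
  cases φ with
  | nil => exact absurd rfl hφ
  | node u φ₁ φ₂ =>
    rw [SplitOddLie.rootedTreeValue, tensorOddLie_proj]
    exact lTensor_bracket_treeValue hM hη hb rfl φ₁ φ₂
      (treeValue_eq_genericTreeEval hM hη hb φ₁) (treeValue_eq_genericTreeEval hM hη hb φ₂)

end treeEval

/-! ### The Kuranishi map of a generic element -/

section kuranishi

variable {k L R J : Type*} [CommRing k] [Invertible (2 : k)] [AddCommGroup L] [Module k L] [Ring R]
  [Algebra k R] {M : ℤ → R → Prop} {A : DGLieAlgebra k L} {η : L →ₗ[k] L}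
  {deg : J → ℤ} {r : J → R} {b : J → L}

/-- The tree sum of `treeBracket`, without the antisymmetrization `αₙ`. -/
def orderedTreeBracket (hη : A.IsSplitting η) (n : ℕ) (deg : Fin n → ℤ) (a : Fin n → L) : L :=
  (-⅟(2 : k)) ^ (n - 1) • ∑ φ : Ot n, treeSign φ.1 •
    treeEval (decorate hη.projBracket hη.g φ.1)
      (fun i => deg (Fin.cast ((numLeaves_decorate _ _ φ.1).trans φ.2) i))
      (fun i => a (Fin.cast ((numLeaves_decorate _ _ φ.1).trans φ.2) i))

theorem treeBracket_eq_sum_orderedTreeBracket (hη : A.IsSplitting η) (n : ℕ)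
    (deg : Fin n → ℤ) (a : Fin n → L) : hη.treeBracket n deg a =
      ∑ σ : Equiv.Perm (Fin n), ((koszulChi σ deg : ℤ) : k) •
        orderedTreeBracket hη n (fun i => deg (σ i)) (fun i => a (σ i)) := by
  simp only [DGLieAlgebra.IsSplitting.treeBracket, orderedTreeBracket, intUnits_smul_eq k,
    Finset.smul_sum]
  rw [Finset.sum_comm]
  refine Finset.sum_congr rfl fun σ _ => Finset.sum_congr rfl fun φ _ => ?_
  simp only [smul_smul]
  congr 1
  ring

theorem kuranishi_eq_sum_orderedTreeBracket [Fintype J] (hM : IsSquareZeroFamily k M)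
    (hη : A.IsSplitting η) (hb : ∀ j, b j ∈ A.gr (deg j)) (m : ℕ) :
    (tensorOddLie hM hη).kuranishi (∑ j, r j ⊗ₜ[k] b j) (m + 1) =
      ∑ f : Fin (m + 2) → J, koszulProd k deg r (List.ofFn f) ⊗ₜ[k]
        orderedTreeBracket hη (m + 2) (fun i => deg (f i)) (fun i => b (f i)) := by
  have neg_half_pow :
      (-⅟(2 : k)) ^ (m + 1) = ⅟(2 : k) ^ (m + 1) * koszulSign k ((m + 1 : ℕ) : ℤ) := by
    rw [neg_pow, koszulSign, Int.cast_negOnePow_natCast, mul_comm]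
  have tree_term (φ : Ot (m + 2)) :
      (tensorOddLie hM hη).rootedTreeValue (tensorOddLie hM hη).proj (∑ j, r j ⊗ₜ[k] b j) φ.1 =
        koszulSign k ((m + 1 : ℕ) : ℤ) • ((treeSign φ.1 : ℤ) : k) •
          genericTreeEval deg r b (decorate hη.projBracket hη.g φ.1) := by
    have numNodes_eq := numNodes_of_mem_Ot φ
    rw [rootedTreeValue_eq_genericTreeEval hM hη hb (numNodes_eq.trans_ne m.succ_ne_zero),
      shiftedTreeSign, numNodes_eq, mul_smul]
  rw [SplitOddLie.kuranishi_eq_sum_rootedTreeValue, sum_treesOfNumNodesEq_eq_sum_Ot,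
    Finset.sum_congr rfl fun φ _ => tree_term φ, ← Finset.smul_sum, smul_smul, ← neg_half_pow]
  simp only [fun φ : Ot (m + 2) => genericTreeEval_of_numLeaves_eq (deg := deg) (r := r) (b := b)
    (decorate hη.projBracket hη.g φ.1) ((numLeaves_decorate _ _ φ.1).trans φ.2),
    Finset.smul_sum, orderedTreeBracket, intUnits_smul_eq k, TensorProduct.tmul_smul,
    TensorProduct.tmul_sum]
  rw [Finset.sum_comm]
  rfl

theorem sum_perm_koszulProd_tmul_orderedTreeBracket (hM : IsSquareZeroFamily k M)
    (hη : A.IsSplitting η) (hr : ∀ j, M (1 - deg j) (r j)) {n : ℕ} (g : Fin n → J) :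
    ∑ σ : Equiv.Perm (Fin n), koszulProd k deg r (List.ofFn (g ∘ σ)) ⊗ₜ[k]
        orderedTreeBracket hη n (fun i => deg (g (σ i))) (fun i => b (g (σ i))) =
      koszulProd k deg r (List.ofFn g) ⊗ₜ[k]
        hη.treeBracket n (fun i => deg (g i)) (fun i => b (g i)) := by
  rw [treeBracket_eq_sum_orderedTreeBracket, TensorProduct.tmul_sum]
  refine Finset.sum_congr rfl fun σ _ => ?_
  have prod_perm := koszulProd_perm (deg := deg ∘ g) (r := r ∘ g) hM (fun j => hr (g j)) σ
  rw [← koszulProd_map, ← koszulProd_map, List.map_ofFn, ← List.ofFn_eq_map] at prod_perm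
  rw [prod_perm, TensorProduct.tmul_smul, TensorProduct.smul_tmul']
  rfl

theorem sum_eq_sum_perm {W : Type*} [Fintype J] [AddCommMonoid W] {n : ℕ} {g : Fin n → J}
    (hg : Function.Injective g) (T : (Fin n → J) → W)
    (hT : ∀ f, (∀ σ : Equiv.Perm (Fin n), g ∘ σ ≠ f) → T f = 0) :
    ∑ f, T f = ∑ σ : Equiv.Perm (Fin n), T (g ∘ σ) := by
  symm
  refine Finset.sum_of_injOn (fun σ : Equiv.Perm (Fin n) => g ∘ σ)
    (fun σ _ τ _ h => DFunLike.coe_injective (hg.comp_left h)) (fun _ _ => Finset.mem_univ _) ?_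
    fun σ _ => rfl
  exact fun f _ hf => hT f fun σ hσ => hf ⟨σ, Finset.mem_univ _, hσ⟩

theorem kuranishi_eq_treeBracket (hM : IsSquareZeroFamily k M) (hη : A.IsSplitting η) {m : ℕ}
    {deg : Fin (m + 2) → ℤ} {r : Fin (m + 2) → R} {b : Fin (m + 2) → L}
    (hr : ∀ j, M (1 - deg j) (r j)) (hb : ∀ j, b j ∈ A.gr (deg j)) :
    (tensorOddLie hM hη).kuranishi (∑ j, r j ⊗ₜ[k] b j) (m + 1) =
      koszulProd k deg r (List.finRange (m + 2)) ⊗ₜ[k] hη.treeBracket (m + 2) deg b := by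
  rw [kuranishi_eq_sum_orderedTreeBracket hM hη hb, ← List.ofFn_id,
    sum_eq_sum_perm Function.injective_id]
  · exact sum_perm_koszulProd_tmul_orderedTreeBracket hM hη hr id
  intro f hf
  have not_injective : ¬ Function.Injective f := fun hi =>
    hf (Equiv.ofBijective f (Finite.injective_iff_bijective.1 hi)) rfl
  obtain ⟨i, j, hij, hne⟩ := Function.not_injective_iff.1 not_injective
  rw [koszulProd_ofFn_eq_zero hM hr hne (hij ▸ hM.sq (hr _)), TensorProduct.zero_tmul]

end kuranishi

/-! ### Graded commutative algebras with square zero generators -/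

section

variable {k R J : Type*} [CommRing k] [Ring R] [Algebra k R]

/-- The scalar multiples of nonempty products of generators `ε i`, with their degrees, where `ε i`
has degree `e i`. -/
inductive IsMonomial (k : Type*) {R J : Type*} [CommRing k] [Ring R] [Algebra k R] (e : J → ℤ)
    (ε : J → R) : ℤ → R → Prop
  | gen (i : J) : IsMonomial k e ε (e i) (ε i)
  | smul {a : ℤ} {r : R} (c : k) : IsMonomial k e ε a r → IsMonomial k e ε a (c • r)
  | mul {a b : ℤ} {r s : R} :
      IsMonomial k e ε a r → IsMonomial k e ε b s → IsMonomial k e ε (a + b) (r * s)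

theorem isSquareZeroFamily_isMonomial {e : J → ℤ} {ε : J → R}
    (hcomm : ∀ i j, ε i * ε j = koszulSign k (e i * e j) • (ε j * ε i)) (hsq : ∀ i, ε i * ε i = 0) :
    IsSquareZeroFamily k (IsMonomial k e ε) := by
  have gen_comm : ∀ (i : J) {b : ℤ} {s : R}, IsMonomial k e ε b s →
      ε i * s = koszulSign k (e i * b) • (s * ε i) := by
    intro i b s hs
    induction hs with
    | gen j => exact hcomm i j
    | smul c _ h => rw [mul_smul_comm, h, smul_mul_assoc, smul_comm]
    | mul _ _ ihr ihs =>
      rw [← mul_assoc, ihr, smul_mul_assoc, mul_assoc, ihs, mul_smul_comm, smul_smul, mul_add,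
        koszulSign_add, mul_assoc]
  have comm : ∀ {a b : ℤ} {r s : R}, IsMonomial k e ε a r → IsMonomial k e ε b s →
      r * s = koszulSign k (a * b) • (s * r) := by
    intro a b r s hr hs
    induction hr with
    | gen i => exact gen_comm i hs
    | smul c _ h => rw [mul_smul_comm, smul_mul_assoc, h, smul_comm]
    | mul _ _ ihr ihs =>
      rw [mul_assoc, ihs, mul_smul_comm, ← mul_assoc, ihr, smul_mul_assoc, smul_smul, add_mul,
        koszulSign_add, mul_assoc, mul_comm (koszulSign k _)]
  refine ⟨IsMonomial.smul, IsMonomial.mul, comm, fun hr => ?_⟩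
  induction hr with
  | gen i => exact hsq i
  | smul c _ h => rw [mul_smul_comm, smul_mul_assoc, h, smul_zero, smul_zero]
  | @mul a b r s hr hs _ ihs =>
    rw [mul_assoc, ← mul_assoc s r s, comm hs hr, smul_mul_assoc, mul_smul_comm, mul_assoc r s s,
      ihs, mul_zero, mul_zero, smul_zero]

end

section

variable (k : Type*) [CommRing k] {ι : Type*} [LinearOrder ι] (e : ι → ℤ)

/-- The sign of moving a generator of index `i` to its place in the ordered product of the
generators with index in `T`, where `e i` is the degree of the generator of index `i`. -/
def generatorSign (i : ι) (T : Finset ι) : k :=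
  ∏ j ∈ T with j < i, koszulSign k (e i * e j)

/-- Left multiplication by the `i`-th generator of the graded exterior algebra on generators of
degree `e i` and square zero. The function `f` stands for the linear combination with coefficient
`f T` at the ordered product of the generators with index in `T`. -/
def mulGenerator (i : ι) : Module.End k (Finset ι → k) where
  toFun f S := if i ∈ S then generatorSign k e i (S.erase i) * f (S.erase i) else 0
  map_add' f g := by
    funext S
    simp only [Pi.add_apply]
    split_ifs
    · rw [mul_add]
    · rw [add_zero]
  map_smul' c f := by
    funext S
    simp only [Pi.smul_apply, smul_eq_mul, RingHom.id_apply]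
    split_ifs
    · rw [mul_left_comm]
    · rw [mul_zero]

theorem mulGenerator_apply (i : ι) (f : Finset ι → k) (S : Finset ι) :
    mulGenerator k e i f S =
      if i ∈ S then generatorSign k e i (S.erase i) * f (S.erase i) else 0 := rfl

theorem generatorSign_erase_of_lt {i j : ι} {T : Finset ι} (hj : j ∈ T) (h : j < i) :
    generatorSign k e i T = koszulSign k (e i * e j) * generatorSign k e i (T.erase j) := by
  rw [generatorSign, generatorSign, Finset.filter_erase,
    Finset.mul_prod_erase _ (fun j => koszulSign k (e i * e j)) (Finset.mem_filter.2 ⟨hj, h⟩)]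

theorem generatorSign_erase_of_not_lt {i j : ι} {T : Finset ι} (h : ¬ j < i) :
    generatorSign k e i (T.erase j) = generatorSign k e i T := by
  rw [generatorSign, generatorSign, Finset.filter_erase, Finset.erase_eq_of_notMem]
  simp [h]

theorem mulGenerator_mul_self (i : ι) : mulGenerator k e i * mulGenerator k e i = 0 := by
  refine LinearMap.ext fun f => funext fun S => ?_
  simp [mulGenerator_apply]

theorem mulGenerator_mul_of_lt {i j : ι} (hij : i < j) :
    mulGenerator k e j * mulGenerator k e i =
      koszulSign k (e j * e i) • (mulGenerator k e i * mulGenerator k e j) := by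
  refine LinearMap.ext fun f => funext fun S => ?_
  simp only [Module.End.mul_apply, LinearMap.smul_apply, Pi.smul_apply, smul_eq_mul,
    mulGenerator_apply, Finset.mem_erase, hij.ne, hij.ne', ne_eq, not_false_eq_true, true_and]
  by_cases hi : i ∈ S
  · by_cases hj : j ∈ S
    · rw [if_pos hj, if_pos hi, if_pos hi, if_pos hj,
        generatorSign_erase_of_lt k e (T := S.erase j) (Finset.mem_erase.2 ⟨hij.ne, hi⟩) hij,
        Finset.erase_right_comm (a := i),
        ← generatorSign_erase_of_not_lt k e (i := i) hij.not_gt (T := S.erase i),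
        Finset.erase_right_comm (a := i) (b := j)]
      ring
    · simp [hj]
  · simp [hi]

theorem mulGenerator_comm (i j : ι) :
    mulGenerator k e i * mulGenerator k e j =
      koszulSign k (e i * e j) • (mulGenerator k e j * mulGenerator k e i) := by
  rcases lt_trichotomy i j with h | rfl | h
  · rw [mulGenerator_mul_of_lt k e h, smul_smul, mul_comm (e j), koszulSign_mul_self, one_smul]
  · rw [mulGenerator_mul_self, smul_zero]
  · exact mulGenerator_mul_of_lt k e h

theorem prod_mulGenerator_apply (w : List ι) (hw : w.Pairwise (· < ·)) :
    (w.map (mulGenerator k e)).prod (Pi.single ∅ 1) w.toFinset = 1 := by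
  induction w with
  | nil => simp
  | cons i w ih =>
    rw [List.pairwise_cons] at hw
    have hi : i ∉ w.toFinset := fun h => lt_irrefl i (hw.1 i (List.mem_toFinset.1 h))
    rw [List.map_cons, List.prod_cons, Module.End.mul_apply, mulGenerator_apply, List.toFinset_cons,
      if_pos (Finset.mem_insert_self _ _), Finset.erase_insert hi, ih hw.2, mul_one, generatorSign,
      Finset.filter_eq_empty_iff.2, Finset.prod_empty]
    intro j hj
    exact (hw.1 j (List.mem_toFinset.1 hj)).not_gt

end

theorem exists_isSquareZeroFamily (k : Type*) [CommRing k] {n : ℕ} (e : Fin n → ℤ) :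
    ∃ (M : ℤ → Module.End k (Finset (Fin n) → k) → Prop)
      (ε : Fin n → Module.End k (Finset (Fin n) → k))
      (φ : Module.End k (Finset (Fin n) → k) →ₗ[k] k),
      IsSquareZeroFamily k M ∧ (∀ i, M (e i) (ε i)) ∧ φ (List.ofFn ε).prod = 1 := by
  refine ⟨IsMonomial k e (mulGenerator k e), mulGenerator k e,
    LinearMap.proj (List.finRange n).toFinset ∘ₗ LinearMap.applyₗ (Pi.single ∅ 1),
    isSquareZeroFamily_isMonomial (mulGenerator_comm k e) (mulGenerator_mul_self k e),
    IsMonomial.gen, ?_⟩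
  rw [List.ofFn_eq_map]
  exact prod_mulGenerator_apply k e _ (List.pairwise_lt_finRange n)

/-! ### The brackets as multilinear maps on `H` -/

section Graded

variable {ι κ k L N : Type*} [DecidableEq ι] [CommRing k] [AddCommGroup L] [Module k L]
  [AddCommGroup N] [Module k N] {gr : ι → Submodule k L}

theorem isInternal_comap_subtype (hgr : DirectSum.IsInternal gr) {H : Submodule k L}
    (π : L →ₗ[k] H) (hπ : ∀ x : H, π x = x) (hπgr : ∀ i, ∀ v ∈ gr i, (π v : L) ∈ gr i) :
    DirectSum.IsInternal fun i => (gr i).comap H.subtype := by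
  refine (DirectSum.isInternal_submodule_iff_iSupIndep_and_iSup_eq_top _).2 ⟨?_, ?_⟩
  · have indep := (iSupIndep_iff_finsetSum_eq_zero_imp_eq_zero gr).1 hgr.submodule_iSupIndep
    refine (iSupIndep_iff_finsetSum_eq_zero_imp_eq_zero _).2 fun s v hv hsum i hi => ?_
    refine Subtype.ext (indep s (fun j => (v j : L)) hv ?_ i hi)
    rw [← H.coe_sum, hsum, H.coe_zero]
  · have le_comap : ⨆ i, gr i ≤ (⨆ i, (gr i).comap H.subtype).comap π :=
      iSup_le fun i v hv =>
        Submodule.mem_iSup_of_mem (p := fun i => (gr i).comap H.subtype) i (hπgr i v hv)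
    refine eq_top_iff.2 fun x _ => ?_
    rw [← hπ x]
    exact le_comap (hgr.submodule_iSup_eq_top ▸ Submodule.mem_top)

/-- The multilinear map which agrees with `m deg` on families of homogeneous elements of degrees
`deg`. -/
noncomputable def multilinearOfHomogeneous [Finite κ] [DecidableEq κ]
    (hgr : DirectSum.IsInternal gr)
    (m : (κ → ι) → MultilinearMap k (fun _ : κ => L) N) : MultilinearMap k (fun _ : κ => L) N :=
  (MultilinearMap.fromDirectSumEquiv (M := fun _ i => gr i) fun deg : κ → ι =>
    (m deg).compLinearMap fun j => (gr (deg j)).subtype).compLinearMap fun _ =>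
      (LinearEquiv.ofBijective (DirectSum.coeLinearMap gr) hgr).symm.toLinearMap

theorem multilinearOfHomogeneous_apply [Finite κ] [DecidableEq κ] (hgr : DirectSum.IsInternal gr)
    (m : (κ → ι) → MultilinearMap k (fun _ : κ => L) N) {deg : κ → ι} {a : κ → L}
    (ha : ∀ j, a j ∈ gr (deg j)) : multilinearOfHomogeneous hgr m a = m deg a := by
  have decompose :
      (fun j => (LinearEquiv.ofBijective (DirectSum.coeLinearMap gr) hgr).symm.toLinearMap (a j)) =
        fun j => DirectSum.lof k ι (fun i => gr i) (deg j) ⟨a j, ha j⟩ :=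
    funext fun j => coeLinearMap_symm_of_mem hgr (ha j)
  rw [multilinearOfHomogeneous, MultilinearMap.compLinearMap_apply, decompose]
  exact MultilinearMap.fromDirectSumEquiv_lof (M := fun _ i => gr i)
    (fun deg : κ → ι => (m deg).compLinearMap fun j => (gr (deg j)).subtype) deg
    fun j => ⟨a j, ha j⟩

end Graded

section treeEval

variable {k L : Type*} [CommRing k] [AddCommGroup L] [Module k L] {gr : ℤ → Submodule k L}

/-- `treeEval` as a multilinear map. -/
noncomputable def treeEvalMultilinear : (φ : BinaryTree (HomogeneousBilin gr)) →
    (Fin φ.numLeaves → ℤ) → MultilinearMap k (fun _ : Fin φ.numLeaves => L) L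
  | .nil, _ => MultilinearMap.ofSubsingleton k L L (0 : Fin 1) LinearMap.id
  | .node b l r, deg =>
      koszulSign k (treeDegree r * ∑ i : Fin l.numLeaves, deg (Fin.castAdd r.numLeaves i)) •
        ((TensorProduct.lift b.map).compMultilinearMap
          ((treeEvalMultilinear l fun i => deg (Fin.castAdd r.numLeaves i)).domCoprod
            (treeEvalMultilinear r fun i => deg (Fin.natAdd l.numLeaves i)))).domDomCongr
          finSumFinEquiv

theorem treeEvalMultilinear_apply (φ : BinaryTree (HomogeneousBilin gr))
    (deg : Fin φ.numLeaves → ℤ) (a : Fin φ.numLeaves → L) :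
    treeEvalMultilinear φ deg a = treeEval φ deg a := by
  induction φ with
  | nil => rfl
  | node b l r hl hr =>
    rw [treeEval, negOnePow_smul_eq (k := k), ← hl, ← hr]
    rfl

end treeEval

namespace DGLieAlgebra.IsSplitting

variable {k L : Type*} [CommRing k] [AddCommGroup L] [Module k L] {A : DGLieAlgebra k L}
  {η : L →ₗ[k] L}

theorem sub_comm_mem_H (hη : A.IsSplitting η) (v : L) :
    (LinearMap.id - A.comm η : L →ₗ[k] L) v ∈ A.H η := by
  rw [DGLieAlgebra.H, LinearMap.mem_ker]
  simp only [DGLieAlgebra.comm, LinearMap.sub_apply, LinearMap.id_apply, LinearMap.add_apply,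
    LinearMap.comp_apply, map_sub, map_add, A.d_d, hη.eta_eta, hη.eta_d_eta, map_zero, add_zero,
    zero_add, hη.d_eta_d, sub_self]

/-- The projection `1 - [d,η]` of `L` onto `H`. -/
def projH (hη : A.IsSplitting η) : L →ₗ[k] A.H η :=
  (LinearMap.id - A.comm η).codRestrict (A.H η) hη.sub_comm_mem_H

theorem coe_projH_of_mem (hη : A.IsSplitting η) {v : L} (hv : v ∈ A.H η) :
    (hη.projH v : L) = v := by
  rw [projH, LinearMap.codRestrict_apply, LinearMap.sub_apply, LinearMap.mem_ker.1 hv, sub_zero,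
    LinearMap.id_apply]

theorem projH_mem_gr (hη : A.IsSplitting η) (i : ℤ) (v : L) (hv : v ∈ A.gr i) :
    (hη.projH v : L) ∈ A.gr i := by
  have d_eta_mem := A.d_mem _ _ (hη.eta_mem _ _ hv)
  have eta_d_mem := hη.eta_mem _ _ (A.d_mem _ _ hv)
  rw [sub_add_cancel] at d_eta_mem
  rw [add_sub_cancel_right] at eta_d_mem
  exact Submodule.sub_mem _ hv (Submodule.add_mem _ d_eta_mem eta_d_mem)

theorem d_of_mem_H (hη : A.IsSplitting η) {v : L} (hv : v ∈ A.H η) : A.d v = 0 := by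
  have d_comm : A.d (A.d (η v) + η (A.d v)) = 0 := by
    rw [show A.d (η v) + η (A.d v) = 0 from LinearMap.mem_ker.1 hv, map_zero]
  rwa [map_add, A.d_d, zero_add, hη.d_eta_d] at d_comm

theorem d_bracket_of_mem_H (hη : A.IsSplitting η) {i : ℤ} {u v : L} (hu : u ∈ A.gr i)
    (hu' : u ∈ A.H η) (hv : v ∈ A.H η) : A.d (A.bracket u v) = 0 := by
  rw [A.d_bracket i u v hu, hη.d_of_mem_H hu', hη.d_of_mem_H hv, map_zero, map_zero,
    LinearMap.zero_apply, smul_zero, add_zero]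

theorem isInternal_grH (hη : A.IsSplitting η) : DirectSum.IsInternal (A.grH η) :=
  isInternal_comap_subtype A.isInternal hη.projH
    (fun x => Subtype.ext (hη.coe_projH_of_mem x.2)) hη.projH_mem_gr

theorem treeDegree_decorate (hη : A.IsSplitting η) {φ : BinaryTree Unit} (hφ : φ ≠ .nil) :
    treeDegree (decorate hη.projBracket hη.g φ) = 2 - (φ.numLeaves : ℤ) := by
  cases φ with
  | nil => exact absurd rfl hφ
  | node u l r =>
    rw [decorate, treeDegree, treeDegree_map_g, treeDegree_map_g, BinaryTree.numLeaves,
      l.numLeaves_eq_numNodes_succ, r.numLeaves_eq_numNodes_succ]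
    simp only [projBracket]
    push_cast
    ring

theorem treeEval_decorate_mem_H (hη : A.IsSplitting η) {φ : BinaryTree Unit} (hφ : φ ≠ .nil)
    (deg : Fin (decorate hη.projBracket hη.g φ).numLeaves → ℤ)
    (a : Fin (decorate hη.projBracket hη.g φ).numLeaves → L) :
    treeEval (decorate hη.projBracket hη.g φ) deg a ∈ A.H η := by
  cases φ with
  | nil => exact absurd rfl hφ
  | node u l r =>
    simp only [decorate, treeEval]
    rw [negOnePow_smul_eq (k := k)]
    exact Submodule.smul_mem _ _ (hη.sub_comm_mem_H _)

variable [Invertible (2 : k)]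

theorem treeBracket_mem_of_treeEval_mem (hη : A.IsSplitting η) {n : ℕ} {deg : Fin n → ℤ}
    {a : Fin n → L} (N : Submodule k L)
    (hN : ∀ (φ : Ot n) (σ : Equiv.Perm (Fin n)), treeEval (decorate hη.projBracket hη.g φ.1)
      (fun i => deg (σ (Fin.cast ((numLeaves_decorate _ _ φ.1).trans φ.2) i)))
      (fun i => a (σ (Fin.cast ((numLeaves_decorate _ _ φ.1).trans φ.2) i))) ∈ N) :
    hη.treeBracket n deg a ∈ N := by
  refine N.smul_mem _ (N.sum_mem fun φ _ => ?_)
  rw [intUnits_smul_eq k]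
  refine N.smul_mem _ (N.sum_mem fun σ _ => ?_)
  rw [intUnits_smul_eq k]
  exact N.smul_mem _ (hN φ σ)

end DGLieAlgebra.IsSplitting

theorem Ot.ne_nil {n : ℕ} (hn : 2 ≤ n) (φ : Ot n) : φ.1 ≠ .nil := by
  intro h
  have numLeaves_eq : φ.1.numLeaves = n := φ.2
  rw [h, BinaryTree.numLeaves] at numLeaves_eq
  omega

namespace DGLieAlgebra.IsSplitting

variable {k L : Type*} [CommRing k] [Invertible (2 : k)] [AddCommGroup L] [Module k L]
  {A : DGLieAlgebra k L} {η : L →ₗ[k] L}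

theorem treeBracket_mem_H (hη : A.IsSplitting η) {n : ℕ} (hn : 2 ≤ n) (deg : Fin n → ℤ)
    (a : Fin n → L) : hη.treeBracket n deg a ∈ A.H η :=
  hη.treeBracket_mem_of_treeEval_mem _ fun φ _ => hη.treeEval_decorate_mem_H (φ.ne_nil hn) _ _

theorem treeBracket_mem_gr (hη : A.IsSplitting η) {n : ℕ} (hn : 2 ≤ n) {deg : Fin n → ℤ}
    {a : Fin n → L} (ha : ∀ i, a i ∈ A.gr (deg i)) :
    hη.treeBracket n deg a ∈ A.gr (∑ i, deg i + 2 - n) := by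
  refine hη.treeBracket_mem_of_treeEval_mem _ fun φ σ => ?_
  let leaves : Fin (decorate hη.projBracket hη.g φ.1).numLeaves ≃ Fin n :=
    (finCongr ((numLeaves_decorate _ _ φ.1).trans φ.2)).trans σ
  have h := treeEval_mem (decorate hη.projBracket hη.g φ.1) (fun i => deg (leaves i))
    (fun i => a (leaves i)) fun i => ha _
  rwa [hη.treeDegree_decorate (φ.ne_nil hn), φ.2, Equiv.sum_comp leaves deg, ← add_sub_assoc] at h

/-- `treeBracket` as a multilinear map. -/
noncomputable def treeBracketMultilinear (hη : A.IsSplitting η) (n : ℕ) (deg : Fin n → ℤ) :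
    MultilinearMap k (fun _ : Fin n => L) L :=
  (-⅟(2 : k)) ^ (n - 1) • ∑ φ : Ot n, ((treeSign φ.1 : ℤ) : k) •
    ∑ σ : Equiv.Perm (Fin n), ((koszulChi σ deg : ℤ) : k) •
      (treeEvalMultilinear (decorate hη.projBracket hη.g φ.1)
        fun i => deg (σ (Fin.cast ((numLeaves_decorate _ _ φ.1).trans φ.2) i))).domDomCongr
      ((finCongr ((numLeaves_decorate hη.projBracket hη.g φ.1).trans φ.2)).trans σ)

theorem treeBracketMultilinear_apply (hη : A.IsSplitting η) (n : ℕ) (deg : Fin n → ℤ)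
    (a : Fin n → L) : hη.treeBracketMultilinear n deg a = hη.treeBracket n deg a := by
  simp only [treeBracketMultilinear, treeBracket, smul_apply,
    sum_apply, MultilinearMap.domDomCongr_apply, intUnits_smul_eq k,
    treeEvalMultilinear_apply]
  rfl

/-- The `n`-ary bracket on `H`: the tree bracket if `n ≥ 2`, and zero otherwise. -/
noncomputable def transferredBracket (hη : A.IsSplitting η) (n : ℕ) :
    MultilinearMap k (fun _ : Fin n => A.H η) (A.H η) :=
  if 2 ≤ n then
    hη.projH.compMultilinearMap
      ((multilinearOfHomogeneous A.isInternal (hη.treeBracketMultilinear n)).compLinearMap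
        fun _ => (A.H η).subtype)
  else 0

theorem transferredBracket_of_lt_two (hη : A.IsSplitting η) {n : ℕ} (hn : n < 2) :
    hη.transferredBracket n = 0 :=
  if_neg (not_le.2 hn)

theorem coe_transferredBracket (hη : A.IsSplitting η) {n : ℕ} (hn : 2 ≤ n) {deg : Fin n → ℤ}
    {a : Fin n → A.H η} (ha : ∀ i, a i ∈ A.grH η (deg i)) :
    (hη.transferredBracket n a : L) = hη.treeBracket n deg fun i => (a i : L) := by
  have homogeneous : multilinearOfHomogeneous A.isInternal (hη.treeBracketMultilinear n)
      (fun i => (a i : L)) = hη.treeBracket n deg fun i => (a i : L) :=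
    (multilinearOfHomogeneous_apply A.isInternal _ (a := fun i => (a i : L)) ha).trans
      (hη.treeBracketMultilinear_apply _ _ _)
  rw [transferredBracket, if_pos hn]
  change ((hη.projH (multilinearOfHomogeneous A.isInternal (hη.treeBracketMultilinear n)
    fun i => (a i : L)) : A.H η) : L) = _
  rw [homogeneous, hη.coe_projH_of_mem (hη.treeBracket_mem_H hn _ _)]

end DGLieAlgebra.IsSplitting

/-! ### Shuffles -/

section shuffles

variable {p n : ℕ}

theorem mem_shuffles {σ : Equiv.Perm (Fin n)} : σ ∈ shuffles p n ↔
    (∀ i j : Fin n, i < j → j.val < p → σ i < σ j) ∧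
    (∀ i j : Fin n, p ≤ i.val → i < j → σ i < σ j) := by
  simp [shuffles]

theorem range_perm_add (hp : p ≤ n) (σ : Equiv.Perm (Fin n)) :
    Set.range (fun j : Fin (n - p) => σ ⟨p + j, by omega⟩) =
      (Set.range fun i => σ (Fin.castLE hp i))ᶜ := by
  ext x
  obtain ⟨y, rfl⟩ := σ.surjective x
  simp only [Set.mem_range, Set.mem_compl_iff, σ.apply_eq_iff_eq, Fin.ext_iff, Fin.val_castLE]
  constructor
  · rintro ⟨j, hj⟩ ⟨i, hi⟩
    omega
  · intro hy
    have le_y : p ≤ y.val := not_lt.1 fun y_lt => hy ⟨⟨y, y_lt⟩, rfl⟩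
    exact ⟨⟨y - p, by omega⟩, Nat.add_sub_cancel' le_y⟩

theorem shuffles_ext (hp : p ≤ n) {σ τ : Equiv.Perm (Fin n)} (hσ : σ ∈ shuffles p n)
    (hτ : τ ∈ shuffles p n) (h : Set.range (fun i => σ (Fin.castLE hp i)) =
      Set.range fun i => τ (Fin.castLE hp i)) : σ = τ := by
  rw [mem_shuffles] at hσ hτ
  have head_eq : (fun i => σ (Fin.castLE hp i)) = fun i => τ (Fin.castLE hp i) :=
    (StrictMono.range_inj (fun (_ j : Fin p) hij => hσ.1 _ _ hij j.2)
      fun (_ j : Fin p) hij => hτ.1 _ _ hij j.2).1 h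
  have tail_eq : (fun j : Fin (n - p) => σ ⟨p + j, by omega⟩) =
      fun j : Fin (n - p) => τ ⟨p + j, by omega⟩ := by
    refine (StrictMono.range_inj (fun i j hij => ?_) (fun i j hij => ?_)).1 ?_
    · exact hσ.2 _ _ (Nat.le_add_right _ _) (Nat.add_lt_add_left hij p)
    · exact hτ.2 _ _ (Nat.le_add_right _ _) (Nat.add_lt_add_left hij p)
    · rw [range_perm_add hp, range_perm_add hp, h]
  refine Equiv.ext fun i => ?_
  by_cases hi : i.val < p
  · exact congrFun head_eq ⟨i, hi⟩
  · have tail_eq_i := congrFun tail_eq ⟨i - p, by omega⟩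
    have add_sub : p + (i.val - p) = i.val := by omega
    simpa only [add_sub] using tail_eq_i

/-- The shuffle which enumerates `S`, and then the complement of `S`, in increasing order. -/
def shuffleOfFinset {S : Finset (Fin n)} (hS : S.card = p) : Equiv.Perm (Fin n) :=
  have hp : p ≤ n := hS ▸ S.card_le_univ.trans_eq (Fintype.card_fin n)
  (finCongr (Nat.add_sub_cancel' hp).symm).trans <| finSumFinEquiv.symm.trans <|
    finSumEquivOfFinset hS (by rw [Finset.card_compl, hS, Fintype.card_fin])

theorem shuffleOfFinset_castLE {S : Finset (Fin n)} (hS : S.card = p) (hp : p ≤ n) (i : Fin p) :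
    shuffleOfFinset hS (Fin.castLE hp i) = S.orderEmbOfFin hS i := by
  have cast_eq : finCongr (Nat.add_sub_cancel' hp).symm (Fin.castLE hp i) =
      Fin.castAdd (n - p) i := rfl
  simp only [shuffleOfFinset, Equiv.trans_apply, cast_eq, finSumFinEquiv_symm_apply_castAdd,
    finSumEquivOfFinset_inl]

theorem shuffleOfFinset_add {S : Finset (Fin n)} (hS : S.card = p) (hS' : Sᶜ.card = n - p)
    (j : Fin (n - p)) : shuffleOfFinset hS ⟨p + j, by omega⟩ = Sᶜ.orderEmbOfFin hS' j := by
  have cast_eq : ∀ h, finCongr h (⟨p + j, by omega⟩ : Fin n) = Fin.natAdd p j := fun _ => rfl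
  simp only [shuffleOfFinset, Equiv.trans_apply, cast_eq, finSumFinEquiv_symm_apply_natAdd,
    finSumEquivOfFinset_inr]

theorem shuffleOfFinset_mem {S : Finset (Fin n)} (hS : S.card = p) :
    shuffleOfFinset hS ∈ shuffles p n := by
  have hp : p ≤ n := hS ▸ S.card_le_univ.trans_eq (Fintype.card_fin n)
  have hS' : Sᶜ.card = n - p := by rw [Finset.card_compl, hS, Fintype.card_fin]
  refine mem_shuffles.2 ⟨fun i j hij hj => ?_, fun i j hi hij => ?_⟩
  · have head := shuffleOfFinset_castLE hS hp
    exact ((head ⟨i, by omega⟩).trans_lt ((S.orderEmbOfFin hS).strictMono hij)).trans_eq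
      (head ⟨j, hj⟩).symm
  · have tail (l : Fin n) (hl : p ≤ l.val) :
        shuffleOfFinset hS l = Sᶜ.orderEmbOfFin hS' ⟨l - p, by omega⟩ := by
      rw [← shuffleOfFinset_add hS hS']
      exact congrArg _ (Fin.ext (Nat.add_sub_cancel' hl).symm)
    rw [tail i hi, tail j (hi.trans hij.le)]
    exact (Sᶜ.orderEmbOfFin hS').strictMono (Nat.sub_lt_sub_right hi hij)

theorem exists_shuffle_comp_perm (hp : p ≤ n) {f : Fin p → Fin n} (hf : Function.Injective f) :
    ∃ σ ∈ shuffles p n, ∃ π : Equiv.Perm (Fin p), ∀ i, f i = σ (Fin.castLE hp (π i)) := by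
  have card_image : (Finset.univ.image f).card = p := by
    rw [Finset.card_image_of_injective _ hf, Finset.card_univ, Fintype.card_fin]
  let π : Fin p → Fin p := fun i =>
    ((Finset.univ.image f).orderIsoOfFin card_image).symm
      ⟨f i, Finset.mem_image_of_mem f (Finset.mem_univ i)⟩
  have π_injective : Function.Injective π := fun i j hij =>
    hf (congrArg Subtype.val (((Finset.univ.image f).orderIsoOfFin card_image).symm.injective hij))
  refine ⟨shuffleOfFinset card_image, shuffleOfFinset_mem card_image,
    Equiv.ofBijective π (Finite.injective_iff_bijective.1 π_injective), fun i => ?_⟩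
  rw [shuffleOfFinset_castLE]
  simp [π, ← Finset.coe_orderIsoOfFin_apply]

theorem sum_eq_sum_shuffles {V : Type*} [AddCommMonoid V] (hp : p ≤ n) (G : (Fin p → Fin n) → V)
    (hG : ∀ f, ¬ Function.Injective f → G f = 0) :
    ∑ f, G f = ∑ σ ∈ shuffles p n, ∑ π : Equiv.Perm (Fin p),
      G fun i => σ (Fin.castLE hp (π i)) := by
  rw [← Finset.sum_product']
  symm
  refine Finset.sum_of_injOn (fun s i => s.1 (Fin.castLE hp (s.2 i))) ?_
    (fun _ _ => Finset.mem_univ _) ?_ fun _ _ => rfl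
  · rintro ⟨σ, π⟩ h ⟨τ, ρ⟩ h' heq
    simp only [Finset.coe_product, Set.mem_prod, Finset.mem_coe] at h h'
    have range_comp_perm (σ : Equiv.Perm (Fin n)) (π : Equiv.Perm (Fin p)) :
        Set.range (fun i => σ (Fin.castLE hp (π i))) = Set.range fun i => σ (Fin.castLE hp i) :=
      π.surjective.range_comp fun i => σ (Fin.castLE hp i)
    obtain rfl : σ = τ := shuffles_ext hp h.1 h'.1 (by
      rw [← range_comp_perm σ π, ← range_comp_perm τ ρ]
      exact congrArg Set.range heq)
    exact Prod.ext rfl (Equiv.ext fun i =>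
      Fin.castLE_injective hp (σ.injective (congrFun heq i)))
  · intro f _ hf
    refine hG f fun hinj => hf ?_
    obtain ⟨σ, hσ, π, h⟩ := exists_shuffle_comp_perm hp hinj
    exact ⟨(σ, π), by simpa using hσ, (funext h).symm⟩

end shuffles

/-! ### Coefficients of products of generators -/

section coefficient

variable {k L R : Type*} [CommRing k] [AddCommGroup L] [Module k L] [Ring R] [Algebra k R]

theorem koszulProd_eq_smul_prod {J : Type*} (deg : J → ℤ) (r : J → R) (w : List J) :
    ∃ s, koszulProd k deg r w = koszulSign k s • (w.map r).prod := by
  induction w with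
  | nil => exact ⟨0, by simp [koszulProd, koszulSign_zero]⟩
  | cons x w ih =>
    obtain ⟨s, hs⟩ := ih
    refine ⟨deg x * w.length + s, ?_⟩
    rw [koszulProd, hs, mul_smul_comm, smul_smul, ← koszulSign_add, List.map_cons, List.prod_cons]

theorem mul_koszulProd_tmul_injective {n : ℕ} {deg : Fin n → ℤ} {r : Fin n → R} {φ : R →ₗ[k] k}
    {ζ : R} (hφ : φ (ζ * (List.ofFn r).prod) = 1) :
    Function.Injective fun v : L => (ζ * koszulProd k deg r (List.finRange n)) ⊗ₜ[k] v := by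
  obtain ⟨s, hs⟩ := koszulProd_eq_smul_prod (k := k) deg r (List.finRange n)
  refine Function.HasLeftInverse.injective
    ⟨fun x => koszulSign k s • TensorProduct.lid k L (φ.rTensor L x), fun v => ?_⟩
  simp only [hs, ← List.ofFn_eq_map, mul_smul_comm]
  rw [LinearMap.rTensor_tmul, map_smul, hφ,
    TensorProduct.lid_tmul, smul_smul, smul_eq_mul, mul_one, koszulSign_mul_self, one_smul]

theorem koszulProd_tmul_injective {n : ℕ} {deg : Fin n → ℤ} {r : Fin n → R} {φ : R →ₗ[k] k}
    (hφ : φ (List.ofFn r).prod = 1) :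
    Function.Injective fun v : L => koszulProd k deg r (List.finRange n) ⊗ₜ[k] v := by
  have one_mul_prod : φ (1 * (List.ofFn r).prod) = 1 := by rw [one_mul, hφ]
  simpa only [one_mul] using mul_koszulProd_tmul_injective (L := L) (deg := deg) one_mul_prod

theorem koszulProd_ofFn_mul_ofFn {M : ℤ → R → Prop} {p q n : ℕ} {deg : Fin n → ℤ} {r : Fin n → R}
    (hM : IsSquareZeroFamily k M) (hr : ∀ j, M (1 - deg j) (r j)) (hpq : p + q = n)
    (σ : Equiv.Perm (Fin n)) :
    koszulProd k deg r (List.ofFn fun i : Fin p => σ (Fin.castLE (by omega) i)) *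
        koszulProd k deg r (List.ofFn fun j : Fin q => σ ⟨p + j, by omega⟩) =
      (koszulSign k ((∑ i : Fin p, deg (σ (Fin.castLE (by omega) i))) * q) *
        ((koszulChi σ deg : ℤ) : k)) • koszulProd k deg r (List.finRange n) := by
  subst hpq
  rw [mul_smul, ← koszulProd_perm hM hr, List.ofFn_add, koszulProd_append, List.map_ofFn,
    List.sum_ofFn, List.length_ofFn, smul_smul]
  exact (one_smul k _).symm.trans (congrArg (· • _) (koszulSign_mul_self _).symm)

end coefficient

section treeBracket

variable {k L : Type*} [CommRing k] [Invertible (2 : k)] [AddCommGroup L] [Module k L]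
  {A : DGLieAlgebra k L} {η : L →ₗ[k] L}

theorem treeBracket_antisymm (hη : A.IsSplitting η) {n : ℕ} (hn : 2 ≤ n) {deg : Fin n → ℤ}
    {a : Fin n → L} (ha : ∀ i, a i ∈ A.gr (deg i)) (σ : Equiv.Perm (Fin n)) :
    hη.treeBracket n (fun i => deg (σ i)) (fun i => a (σ i)) =
      koszulChi σ deg • hη.treeBracket n deg a := by
  obtain ⟨m, rfl⟩ := Nat.exists_eq_add_of_le' hn
  obtain ⟨M, ε, φ, hM, hε, hφ⟩ := exists_isSquareZeroFamily k fun i => 1 - deg i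
  have prod_perm : koszulProd k (fun i => deg (σ i)) (fun i => ε (σ i)) (List.finRange (m + 2)) =
      ((koszulChi σ deg : ℤ) : k) • koszulProd k deg ε (List.finRange (m + 2)) := by
    rw [← koszulProd_perm hM hε, List.ofFn_eq_map, koszulProd_map]
    rfl
  have kuranishi_perm := kuranishi_eq_treeBracket hM hη (fun j => hε (σ j)) fun j => ha (σ j)
  rw [Equiv.sum_comp σ fun j => ε j ⊗ₜ[k] a j, kuranishi_eq_treeBracket hM hη hε ha, prod_perm,
    TensorProduct.smul_tmul] at kuranishi_perm
  rw [koszulProd_tmul_injective hφ kuranishi_perm, intUnits_smul_eq k, smul_smul, ← Int.cast_mul,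
    Int.units_coe_mul_self, Int.cast_one, one_smul]

theorem treeBracket_two (hη : A.IsSplitting η) {deg : Fin 2 → ℤ} {a : Fin 2 → L}
    (ha : ∀ i, a i ∈ A.gr (deg i)) : hη.treeBracket 2 deg a =
      (LinearMap.id - A.comm η : L →ₗ[k] L) (A.bracket (a 0) (a 1)) := by
  obtain ⟨M, ε, φ, hM, hε, hφ⟩ := exists_isSquareZeroFamily k fun i => 1 - deg i
  have hx (i : Fin 2) : ε i ⊗ₜ[k] a i ∈ totalDegree M A.gr 1 :=
    tmul_mem_totalDegree (hε i) (ha i) (sub_add_cancel _ _)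
  have bracket_self (i : Fin 2) : tensorBracket _ A (ε i ⊗ₜ[k] a i) (ε i ⊗ₜ[k] a i) = 0 := by
    rw [tensorBracket_tmul (ha i), hM.sq (hε i), TensorProduct.zero_tmul, smul_zero]
  have prod_eq : koszulProd k deg ε (List.finRange 2) = koszulSign k (deg 0) • (ε 0 * ε 1) := by
    simp [List.finRange_succ, koszulProd, koszulSign_zero]
  have bracket_sum : tensorBracket _ A (∑ i, ε i ⊗ₜ[k] a i) (∑ i, ε i ⊗ₜ[k] a i) =
      (2 : k) • (koszulProd k deg ε (List.finRange 2) ⊗ₜ[k] A.bracket (a 0) (a 1)) := by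
    simp only [Fin.sum_univ_two, map_add, LinearMap.add_apply, bracket_self]
    rw [tensorBracket_symm hM _ (hx 1) _ (hx 0), zero_add, add_zero, ← two_smul k,
      tensorBracket_tmul (ha 0), prod_eq, TensorProduct.smul_tmul']
  refine koszulProd_tmul_injective hφ ((kuranishi_eq_treeBracket hM hη hε ha).symm.trans ?_)
  rw [SplitOddLie.kuranishi_succ, SplitOddLie.series_bracket_succ,
    Finset.Nat.antidiagonal_zero, Finset.sum_singleton, SplitOddLie.fixedPoint_zero,
    tensorOddLie_proj]
  change ⅟(2 : k) • (LinearMap.id - A.comm η).lTensor _ (tensorBracket _ A _ _) = _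
  rw [bracket_sum, map_smul, invOf_smul_smul, LinearMap.lTensor_tmul]

end treeBracket

/-! ### The derivative of the Kuranishi map -/

section adjoin

theorem exists_perm_comp_eq {J : Type*} {n : ℕ} {f g : Fin n → J} (hf : Function.Injective f)
    (h : ∀ i, f i ∈ Set.range g) : ∃ σ : Equiv.Perm (Fin n), g ∘ σ = f := by
  choose σ hσ using h
  have σ_injective : Function.Injective σ := fun i j hij => hf (by rw [← hσ, ← hσ, hij])
  exact ⟨Equiv.ofBijective σ (Finite.injective_iff_bijective.1 σ_injective), funext hσ⟩

theorem sum_option_eq_add_sum_perm {J W : Type*} [Fintype J] [AddCommMonoid W] {n : ℕ}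
    {g : Fin n → Option J} (hg : Function.Injective g) (hnone : none ∈ Set.range g)
    (T : (Fin n → Option J) → W)
    (hT : ∀ f, none ∈ Set.range f → (∀ σ : Equiv.Perm (Fin n), g ∘ σ ≠ f) → T f = 0) :
    ∑ f, T f = ∑ f : Fin n → J, T (some ∘ f) + ∑ σ : Equiv.Perm (Fin n), T (g ∘ σ) := by
  classical
  have sum_some : ∑ f : Fin n → J, T (some ∘ f) =
      ∑ f : Fin n → Option J, if none ∈ Set.range f then 0 else T f := by
    refine Finset.sum_of_injOn (fun f => some ∘ f) ((Option.some_injective J).comp_left.injOn)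
      (fun _ _ => Finset.mem_univ _) (fun f _ hf => if_pos ?_) fun f _ => (if_neg ?_).symm
    · by_contra hnone
      choose f₀ hf₀ using fun i => Option.ne_none_iff_exists.1 fun h => hnone ⟨i, h⟩
      exact hf ⟨f₀, Finset.mem_univ _, funext hf₀⟩
    · rintro ⟨i, hi⟩
      exact Option.some_ne_none _ hi
  have sum_none : ∑ σ : Equiv.Perm (Fin n), T (g ∘ σ) =
      ∑ f : Fin n → Option J, if none ∈ Set.range f then T f else 0 := by
    rw [sum_eq_sum_perm hg _ fun f hf => ite_eq_right_iff.2 fun h => hT f h hf]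
    refine Finset.sum_congr rfl fun σ _ => (if_pos ?_).symm
    rwa [σ.surjective.range_comp]
  rw [sum_some, sum_none, ← Finset.sum_add_distrib]
  exact Finset.sum_congr rfl fun f _ => by split_ifs <;> simp only [zero_add, add_zero]

variable {k L R J : Type*} [CommRing k] [AddCommGroup L] [Module k L]
  [Ring R] [Algebra k R] {M : ℤ → R → Prop} {A : DGLieAlgebra k L} {η : L →ₗ[k] L}

theorem sum_tmul_mem_totalDegree [Fintype J] {deg : J → ℤ} {r : J → R} {b : J → L}
    (hr : ∀ j, M (1 - deg j) (r j)) (hb : ∀ j, b j ∈ A.gr (deg j)) :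
    ∑ j, r j ⊗ₜ[k] b j ∈ totalDegree M A.gr 1 :=
  Submodule.sum_mem _ fun j _ => tmul_mem_totalDegree (hr j) (hb j) (sub_add_cancel _ _)

theorem rTensor_mulLeft_mem (hM : IsSquareZeroFamily k M) {c m n : ℤ} {ζ : R} (hζ : M c ζ)
    (h : c + m = n) {x : R ⊗[k] L} (hx : x ∈ totalDegree M A.gr m) :
    (LinearMap.mulLeft k ζ).rTensor L x ∈ totalDegree M A.gr n := by
  suffices h : (totalDegree M A.gr m).map ((LinearMap.mulLeft k ζ).rTensor L) ≤
      totalDegree M A.gr n from h (Submodule.mem_map_of_mem hx)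
  rw [totalDegree, Submodule.map_span_le]
  rintro _ ⟨i, r, u, hr, hu, rfl⟩
  exact tmul_mem_totalDegree (hM.mul hζ hr) hu (by omega)

theorem tensorBracket_mulLeft_mulLeft (hM : IsSquareZeroFamily k M) {c m n : ℤ} {ζ : R}
    (hζ : M c ζ) : ∀ x ∈ totalDegree M A.gr m, ∀ y ∈ totalDegree M A.gr n,
      tensorBracket R A ((LinearMap.mulLeft k ζ).rTensor L x)
        ((LinearMap.mulLeft k ζ).rTensor L y) = 0 := by
  let Z := (LinearMap.mulLeft k ζ).rTensor L
  refine bilinear_eqOn_span (f := (tensorBracket R A).compl₁₂ Z Z) (g := 0) ?_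
  rintro _ ⟨i, r, u, hr, hu, rfl⟩ _ ⟨j, s, v, -, -, rfl⟩
  have mul_mul_eq_zero : ζ * r * (ζ * s) = 0 := by
    rw [hM.comm hζ hr, smul_mul_assoc, mul_assoc, ← mul_assoc ζ, hM.sq hζ, zero_mul, mul_zero,
      smul_zero]
  rw [LinearMap.compl₁₂_apply, LinearMap.rTensor_tmul, LinearMap.rTensor_tmul,
    tensorBracket_tmul hu, LinearMap.mulLeft_apply, LinearMap.mulLeft_apply, mul_mul_eq_zero,
    TensorProduct.zero_tmul, smul_zero]
  rfl

variable [Invertible (2 : k)]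

theorem kuranishi_sum_option [Fintype J] (hM : IsSquareZeroFamily k M) (hη : A.IsSplitting η)
    {deg : Option J → ℤ} {r : Option J → R} {b : Option J → L} (hr : ∀ j, M (1 - deg j) (r j))
    (hb : ∀ j, b j ∈ A.gr (deg j)) {m : ℕ} {t : Fin (m + 1) → J} (ht : Function.Injective t)
    (hrt : ∀ j ∉ Set.range t, r none * r (some j) = 0) {g : Fin (m + 2) → Option J}
    (hg : g = Fin.cons none fun i => some (t i)) :
    (tensorOddLie hM hη).kuranishi (∑ j, r j ⊗ₜ[k] b j) (m + 1) =
      (tensorOddLie hM hη).kuranishi (∑ j, r (some j) ⊗ₜ[k] b (some j)) (m + 1) +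
        koszulProd k deg r (List.ofFn g) ⊗ₜ[k]
          hη.treeBracket (m + 2) (fun i => deg (g i)) fun i => b (g i) := by
  have g_injective : Function.Injective g := hg ▸ Fin.cons_injective_iff.2
    ⟨fun ⟨_, h⟩ => Option.some_ne_none _ h, (Option.some_injective J).comp ht⟩
  have g_zero : g 0 = none := by rw [hg, Fin.cons_zero]
  rw [kuranishi_eq_sum_orderedTreeBracket hM hη hb,
    kuranishi_eq_sum_orderedTreeBracket hM hη fun j => hb (some j),
    sum_option_eq_add_sum_perm g_injective ⟨0, g_zero⟩]
  · congr 1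
    · refine Finset.sum_congr rfl fun f _ => congrArg (· ⊗ₜ[k] _) ?_
      rw [← List.map_ofFn, koszulProd_map]
      rfl
    · exact sum_perm_koszulProd_tmul_orderedTreeBracket hM hη hr g
  · rintro f ⟨i₀, hi₀⟩ hf
    by_contra hne
    have mul_ne_zero (i j : Fin (m + 2)) (hij : i ≠ j) : r (f i) * r (f j) ≠ 0 := fun h =>
      hne (by rw [koszulProd_ofFn_eq_zero hM hr hij h, TensorProduct.zero_tmul])
    have f_injective : Function.Injective f := fun i j h => by
      by_contra hij
      exact mul_ne_zero i j hij (h ▸ hM.sq (hr _))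
    obtain ⟨σ, hσ⟩ := exists_perm_comp_eq (g := g) f_injective fun i => by
      rcases hfi : f i with _ | j
      · exact ⟨0, g_zero⟩
      · by_contra hj
        have j_notMem : j ∉ Set.range t := fun ⟨l, hl⟩ =>
          hj ⟨l.succ, by rw [hg, Fin.cons_succ, hl]⟩
        refine mul_ne_zero i₀ i ?_ (by rw [hi₀, hfi, hrt j j_notMem])
        rintro rfl
        exact Option.some_ne_none j (hfi.symm.trans hi₀)
    exact hf σ hσ

theorem kuranishi_add_mulLeft (hM : IsSquareZeroFamily k M) (hη : A.IsSplitting η) {ζ : R}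
    (hζ : M (-1) ζ) {x y : R ⊗[k] L} (hx : x ∈ totalDegree M A.gr 1)
    (hy : y ∈ totalDegree M A.gr 2) (m : ℕ) :
    (tensorOddLie hM hη).kuranishi (x + (LinearMap.mulLeft k ζ).rTensor L y) m =
      (tensorOddLie hM hη).kuranishi x m +
        (LinearMap.mulLeft k ζ).rTensor L ((tensorOddLie hM hη).kuranishiDeriv x y m) := by
  have lTensor_rTensor (f : L →ₗ[k] L) (v : R ⊗[k] L) :
      f.lTensor R ((LinearMap.mulLeft k ζ).rTensor L v) =
        (LinearMap.mulLeft k ζ).rTensor L (f.lTensor R v) := by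
    rw [← LinearMap.comp_apply, ← LinearMap.comp_apply, LinearMap.lTensor_comp_rTensor,
      LinearMap.rTensor_comp_lTensor]
  have deriv_mem := fixedPointDeriv_mem_totalDegree hM hη hx hy
  refine SplitOddLie.kuranishi_add (lTensor_rTensor η) (tensorBracket_rTensor_mulLeft ζ) hx
    (fun i => rTensor_mulLeft_mem hM hζ (by norm_num) (deriv_mem i))
    (fun i j => tensorBracket_mulLeft_mulLeft hM hζ _ (deriv_mem i) _ (deriv_mem j)) ?_ m
  rw [tensorOddLie_proj]
  exact lTensor_rTensor _

theorem mulLeft_kuranishiDeriv_tmul [Fintype J] (hM : IsSquareZeroFamily k M)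
    (hη : A.IsSplitting η) {deg : J → ℤ} {r : J → R} {b : J → L} (hr : ∀ j, M (1 - deg j) (r j))
    (hb : ∀ j, b j ∈ A.gr (deg j)) {ζ : R} (hζ : M (-1) ζ) {c : ℤ} {s : R} {v : L}
    (hs : M (2 - c) s) (hv : v ∈ A.gr c) {m : ℕ} {t : Fin (m + 1) → J}
    (ht : Function.Injective t) (hst : ∀ j ∉ Set.range t, s * r j = 0) :
    (LinearMap.mulLeft k ζ).rTensor L
        ((tensorOddLie hM hη).kuranishiDeriv (∑ j, r j ⊗ₜ[k] b j) (s ⊗ₜ[k] v) (m + 1)) =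
      (koszulSign k (c * (m + 1 : ℕ)) • (ζ * s * koszulProd k deg r (List.ofFn t))) ⊗ₜ[k]
        hη.treeBracket (m + 2) (Fin.cons c fun i => deg (t i)) (Fin.cons v fun i => b (t i)) := by
  let deg' : Option J → ℤ := fun j => j.elim c deg
  let r' : Option J → R := fun j => j.elim (ζ * s) r
  let b' : Option J → L := fun j => j.elim v b
  have hr' : ∀ j, M (1 - deg' j) (r' j) :=
    Option.forall.2 ⟨(show -1 + (2 - c) = 1 - c by ring) ▸ hM.mul hζ hs, hr⟩
  have hb' : ∀ j, b' j ∈ A.gr (deg' j) := Option.forall.2 ⟨hv, hb⟩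
  have sum_option : ∑ j, r' j ⊗ₜ[k] b' j =
      ∑ j, r j ⊗ₜ[k] b j + (LinearMap.mulLeft k ζ).rTensor L (s ⊗ₜ[k] v) := by
    rw [Fintype.sum_option, add_comm]
    rfl
  have kuranishi_eq := kuranishi_sum_option hM hη hr' hb' ht
    (fun j hj => by simp only [r', Option.elim, mul_assoc, hst j hj, mul_zero]) rfl
  rw [sum_option, kuranishi_add_mulLeft hM hη hζ (sum_tmul_mem_totalDegree hr hb)
    (tmul_mem_totalDegree hs hv (sub_add_cancel _ _))] at kuranishi_eq
  refine (add_left_cancel kuranishi_eq).trans ?_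
  have prod_eq : koszulProd k deg' r' (List.ofFn (Fin.cons none fun i => some (t i))) =
      koszulSign k (c * (m + 1 : ℕ)) • (ζ * s * koszulProd k deg r (List.ofFn t)) := by
    rw [List.ofFn_succ, koszulProd, List.length_ofFn]
    simp only [Fin.cons_zero, Fin.cons_succ]
    exact congrArg (fun x => koszulSign k (c * (m + 1 : ℕ)) • (ζ * s * x))
      (List.map_ofFn (f := t) (g := some) ▸ koszulProd_map some (List.ofFn t))
  rw [prod_eq]
  congr 2
  · exact funext (Fin.cases rfl fun _ => rfl)
  · exact funext (Fin.cases rfl fun _ => rfl)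

end adjoin

/-! ### The generalised Jacobi identity -/

section shuffleExpansion

variable {k R : Type*} [CommRing k] [Ring R] [Algebra k R] {M : ℤ → R → Prop} {n : ℕ}
  {deg : Fin n → ℤ} {r : Fin n → R}

theorem koszulProd_ofFn_mem (hM : IsSquareZeroFamily k M) (hr : ∀ j, M (1 - deg j) (r j)) {p : ℕ}
    (hp : p ≠ 0) (f : Fin p → Fin n) :
    M (2 - (∑ i, deg (f i) + 2 - p)) (koszulProd k deg r (List.ofFn f)) := by
  have h := koszulProd_mem hM hr (List.ofFn f) (by rwa [Ne, List.ofFn_eq_nil_iff])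
  rw [List.map_ofFn, List.sum_ofFn] at h
  convert h using 1
  simp only [Function.comp_apply, Finset.sum_sub_distrib, Finset.sum_const, Finset.card_univ,
    Fintype.card_fin, nsmul_eq_mul, mul_one]
  ring

variable {L : Type*} [Invertible (2 : k)] [AddCommGroup L] [Module k L] {A : DGLieAlgebra k L}
  {η : L →ₗ[k] L} {b : Fin n → L}

theorem kuranishi_eq_sum_shuffles (hM : IsSquareZeroFamily k M) (hη : A.IsSplitting η) {m : ℕ}
    (hm : m + 2 ≤ n) (hr : ∀ j, M (1 - deg j) (r j)) (hb : ∀ j, b j ∈ A.gr (deg j)) :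
    (tensorOddLie hM hη).kuranishi (∑ j, r j ⊗ₜ[k] b j) (m + 1) =
      ∑ σ ∈ shuffles (m + 2) n,
        koszulProd k deg r (List.ofFn fun i => σ (Fin.castLE hm i)) ⊗ₜ[k]
          hη.treeBracket (m + 2) (fun i => deg (σ (Fin.castLE hm i)))
            fun i => b (σ (Fin.castLE hm i)) := by
  rw [kuranishi_eq_sum_orderedTreeBracket hM hη hb, sum_eq_sum_shuffles hm]
  · exact Finset.sum_congr rfl fun σ _ =>
      sum_perm_koszulProd_tmul_orderedTreeBracket hM hη hr fun i => σ (Fin.castLE hm i)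
  · intro f hf
    obtain ⟨i, j, hij, hne⟩ := Function.not_injective_iff.1 hf
    rw [koszulProd_ofFn_eq_zero hM hr hne (hij ▸ hM.sq (hr _)), TensorProduct.zero_tmul]

theorem mulLeft_kuranishiDeriv_koszulProd (hM : IsSquareZeroFamily k M) (hη : A.IsSplitting η)
    {p q : ℕ} (hp : 2 ≤ p) (hpq : p + (q + 1) = n) (hr : ∀ j, M (1 - deg j) (r j))
    (hb : ∀ j, b j ∈ A.gr (deg j)) {ζ : R} (hζ : M (-1) ζ) (σ : Equiv.Perm (Fin n)) {c : ℤ}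
    (hc : c = ∑ i : Fin p, deg (σ (Fin.castLE (by omega) i)) + 2 - p) {v : L} (hv : v ∈ A.gr c) :
    (LinearMap.mulLeft k ζ).rTensor L ((tensorOddLie hM hη).kuranishiDeriv (∑ j, r j ⊗ₜ[k] b j)
        (koszulProd k deg r (List.ofFn fun i : Fin p => σ (Fin.castLE (by omega) i)) ⊗ₜ[k] v)
        (q + 1)) =
      (ζ * koszulProd k deg r (List.finRange n)) ⊗ₜ[k]
        ((Int.negOnePow (p * (q + 1 : ℕ)) * koszulChi σ deg) •
          hη.treeBracket (q + 2) (Fin.cons c fun j => deg (σ ⟨p + j, by omega⟩))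
            (Fin.cons v fun j => b (σ ⟨p + j, by omega⟩))) := by
  have head_mem := koszulProd_ofFn_mem hM hr (by omega) fun i : Fin p =>
    σ (Fin.castLE (by omega) i)
  rw [← hc] at head_mem
  have tail_injective : Function.Injective fun j : Fin (q + 1) => σ ⟨p + j, by omega⟩ :=
    fun i j hij => Fin.ext (Nat.add_left_cancel (Fin.ext_iff.1 (σ.injective hij)))
  have head_mul (j : Fin n) (hj : j ∉ Set.range fun j : Fin (q + 1) => σ ⟨p + j, by omega⟩) :
      koszulProd k deg r (List.ofFn fun i : Fin p => σ (Fin.castLE (by omega) i)) * r j = 0 := by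
    obtain ⟨i, rfl⟩ := σ.surjective j
    have i_lt : i.val < p := not_le.1 fun hi => hj ⟨⟨i - p, by omega⟩, by
      simp only [Nat.add_sub_cancel' hi]⟩
    have mem_head : σ i ∈ List.ofFn fun i : Fin p => σ (Fin.castLE (by omega) i) :=
      List.mem_ofFn.2 ⟨⟨i, i_lt⟩, rfl⟩
    rw [hM.comm head_mem (hr _),
      mul_koszulProd_eq_zero hM hr (hr _) (hM.sq (hr _)) _ mem_head, smul_zero]
  rw [mulLeft_kuranishiDeriv_tmul hM hη hr hb hζ head_mem hv tail_injective head_mul, mul_assoc,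
    koszulProd_ofFn_mul_ofFn hM hr hpq, mul_smul_comm, smul_smul, ← mul_assoc, ← koszulSign_add,
    TensorProduct.smul_tmul, intUnits_smul_eq k, Units.val_mul, Int.cast_mul]
  congr 3
  refine koszulSign_congr ?_
  rw [hc]
  push_cast
  generalize ∑ i : Fin p, deg (σ (Fin.castLE _ i)) = S
  generalize (p : ℤ) = p'
  generalize (q : ℤ) = q'
  grind [Int.even_add, Int.even_sub, Int.not_even_one]

end shuffleExpansion

namespace DGLieAlgebra.IsSplitting

variable {k L : Type*} [CommRing k] [Invertible (2 : k)] [AddCommGroup L] [Module k L]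
  {A : DGLieAlgebra k L} {η : L →ₗ[k] L} {p q n : ℕ} {deg : Fin n → ℤ} {a : Fin n → A.H η}

/-- The summand of the generalised Jacobi identity of the transferred brackets which belongs to
a `(p, q)`-shuffle `σ`. -/
noncomputable def jacobiTerm (hη : A.IsSplitting η) (hpq : p + q = n) (deg : Fin n → ℤ)
    (a : Fin n → A.H η) (σ : Equiv.Perm (Fin n)) : A.H η :=
  (Int.negOnePow (p * q) * koszulChi σ deg) • hη.transferredBracket (q + 1)
    (Fin.cons (hη.transferredBracket p fun i => a (σ ⟨i, by omega⟩))
      fun j => a (σ ⟨p + j, by omega⟩))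

theorem jacobiTerm_of_left_lt_two (hη : A.IsSplitting η) (hpq : p + q = n) (hp : p < 2)
    (σ : Equiv.Perm (Fin n)) : hη.jacobiTerm hpq deg a σ = 0 := by
  rw [jacobiTerm, hη.transferredBracket_of_lt_two hp, zero_apply,
    MultilinearMap.map_coord_zero _ 0 (Fin.cons_zero _ _), smul_zero]

theorem jacobiTerm_zero_right (hη : A.IsSplitting η) (hpq : p + 0 = n)
    (σ : Equiv.Perm (Fin n)) : hη.jacobiTerm hpq deg a σ = 0 := by
  rw [jacobiTerm, hη.transferredBracket_of_lt_two (by norm_num), zero_apply, smul_zero]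

theorem coe_jacobiTerm (hη : A.IsSplitting η) (hpq : p + (q + 1) = n) (hp : 2 ≤ p)
    (ha : ∀ i, a i ∈ A.grH η (deg i)) (σ : Equiv.Perm (Fin n)) {c : ℤ} {v : L} (hv : v ∈ A.gr c)
    (hpv : v = hη.treeBracket p (fun i => deg (σ (Fin.castLE (by omega) i)))
      fun i => (a (σ (Fin.castLE (by omega) i)) : L)) :
    (hη.jacobiTerm hpq deg a σ : L) = (Int.negOnePow (p * (q + 1 : ℕ)) * koszulChi σ deg) •
      hη.treeBracket (q + 2) (Fin.cons c fun j => deg (σ ⟨p + j, by omega⟩))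
        (Fin.cons v fun j => (a (σ ⟨p + j, by omega⟩) : L)) := by
  have coe_head : (hη.transferredBracket p fun i => a (σ ⟨i, by omega⟩) : L) = v :=
    (hη.coe_transferredBracket hp fun i => ha _).trans hpv.symm
  rw [jacobiTerm, intUnits_smul_eq k, Submodule.coe_smul, ← intUnits_smul_eq k,
    hη.coe_transferredBracket (by omega)
      (deg := Fin.cons c fun j : Fin (q + 1) => deg (σ ⟨p + j, by omega⟩))
      (Fin.cases (coe_head ▸ hv) fun i => ha _)]
  congr 2
  exact funext (Fin.cases coe_head fun _ => rfl)

end DGLieAlgebra.IsSplitting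

section jacobi

variable {k L R : Type*} [CommRing k] [Invertible (2 : k)] [AddCommGroup L] [Module k L] [Ring R]
  [Algebra k R] {M : ℤ → R → Prop} {A : DGLieAlgebra k L} {η : L →ₗ[k] L} {n : ℕ}
  {deg : Fin n → ℤ} {a : Fin n → A.H η}

theorem mulLeft_kuranishiDeriv_kuranishi (hM : IsSquareZeroFamily k M) (hη : A.IsSplitting η)
    {p q : ℕ} (hpq : p + 1 + q = n) {r : Fin n → R} (hr : ∀ j, M (1 - deg j) (r j))
    (ha : ∀ j, a j ∈ A.grH η (deg j)) {ζ : R} (hζ : M (-1) ζ) :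
    (LinearMap.mulLeft k ζ).rTensor L
        ((tensorOddLie hM hη).kuranishiDeriv (∑ j, r j ⊗ₜ[k] (a j : L))
          ((tensorOddLie hM hη).kuranishi (∑ j, r j ⊗ₜ[k] (a j : L)) p) q) =
      (ζ * koszulProd k deg r (List.finRange n)) ⊗ₜ[k]
        ((∑ σ ∈ shuffles (p + 1) n, hη.jacobiTerm hpq deg a σ : A.H η) : L) := by
  rcases p with _ | m
  · rw [SplitOddLie.kuranishi_zero, map_zero, Pi.zero_apply, map_zero,
      Finset.sum_eq_zero fun σ _ => hη.jacobiTerm_of_left_lt_two hpq one_lt_two σ,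
      ZeroMemClass.coe_zero, TensorProduct.tmul_zero]
  rcases q with _ | q
  · rw [SplitOddLie.kuranishiDeriv_zero, map_zero,
      Finset.sum_eq_zero fun σ _ => hη.jacobiTerm_zero_right hpq σ,
      ZeroMemClass.coe_zero, TensorProduct.tmul_zero]
  rw [kuranishi_eq_sum_shuffles (b := fun j => (a j : L)) hM hη (by omega) hr ha, map_sum,
    Finset.sum_apply, map_sum, AddSubmonoidClass.coe_finsetSum, TensorProduct.tmul_sum]
  refine Finset.sum_congr rfl fun σ _ => ?_
  have head_mem := hη.treeBracket_mem_gr (n := m + 2) (by omega)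
    (a := fun i => (a (σ (Fin.castLE (by omega) i)) : L)) fun i => ha _
  rw [mulLeft_kuranishiDeriv_koszulProd (p := m + 2) (b := fun j => (a j : L)) hM hη (by omega) hpq
    hr ha hζ σ rfl head_mem, hη.coe_jacobiTerm hpq (by omega) ha σ head_mem rfl]

end jacobi

namespace DGLieAlgebra.IsSplitting

variable {k L : Type*} [CommRing k] [Invertible (2 : k)] [AddCommGroup L] [Module k L]
  {A : DGLieAlgebra k L} {η : L →ₗ[k] L} {n : ℕ} {deg : Fin n → ℤ} {a : Fin n → A.H η}

theorem sum_jacobiTerm_succ (hη : A.IsSplitting η) (ha : ∀ i, a i ∈ A.grH η (deg i)) {m : ℕ}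
    (hm : m + 1 = n) :
    ∑ p : Fin (m + 1), ∑ σ ∈ shuffles (p + 1) n,
      hη.jacobiTerm (p := p + 1) (q := m - p) (by omega) deg a σ = 0 := by
  obtain ⟨M, ε, φ, hM, hε, hφ⟩ :=
    exists_isSquareZeroFamily k (Fin.cons (-1) fun i => 1 - deg i : Fin (n + 1) → ℤ)
  have hr (i : Fin n) : M (1 - deg i) (ε i.succ) := hε i.succ
  have d_sum : (tensorOddLie hM hη).d (∑ i, ε i.succ ⊗ₜ[k] (a i : L)) = 0 := by
    change A.d.lTensor _ _ = 0
    rw [map_sum]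
    refine Finset.sum_eq_zero fun i _ => ?_
    rw [LinearMap.lTensor_tmul, hη.d_of_mem_H (a i).2, TensorProduct.tmul_zero]
  have deriv_eq_zero := congrArg ((LinearMap.mulLeft k (ε 0)).rTensor L)
    ((tensorOddLie hM hη).sum_kuranishiDeriv_kuranishi
      (sum_tmul_mem_totalDegree (b := fun i => (a i : L)) hr ha) d_sum m)
  rw [map_zero, Finset.Nat.sum_antidiagonal_eq_sum_range_succ_mk, Finset.sum_range, map_sum,
    Finset.sum_congr rfl fun (p : Fin (m + 1)) _ =>
      mulLeft_kuranishiDeriv_kuranishi (p := (p : ℕ)) (q := m - p) hM hη (by omega) hr ha (hε 0),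
    ← TensorProduct.tmul_sum, ← AddSubmonoidClass.coe_finsetSum] at deriv_eq_zero
  rw [List.ofFn_succ, List.prod_cons] at hφ
  exact Subtype.ext (mul_koszulProd_tmul_injective hφ
    (deriv_eq_zero.trans (TensorProduct.tmul_zero _ _).symm))

theorem transferredBracket_jacobi (hη : A.IsSplitting η) (n : ℕ) (deg : Fin n → ℤ)
    (a : Fin n → A.H η) (ha : ∀ i, a i ∈ A.grH η (deg i)) :
    ∑ p : Fin (n + 1), ∑ σ ∈ shuffles p n,
      hη.jacobiTerm (p := p) (q := n - p) (by omega) deg a σ = 0 := by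
  have head_eq_zero : ∑ σ ∈ shuffles 0 n,
      hη.jacobiTerm (p := 0) (q := n - 0) (by omega) deg a σ = 0 :=
    Finset.sum_eq_zero fun σ _ => hη.jacobiTerm_of_left_lt_two _ Nat.zero_lt_two σ
  rw [Fin.sum_univ_succ]
  refine (congrArg (· + _) head_eq_zero).trans ((zero_add _).trans ?_)
  cases n with
  | zero => exact Finset.sum_empty
  | succ m =>
    refine Eq.trans (Finset.sum_congr rfl fun p _ => ?_) (hη.sum_jacobiTerm_succ ha rfl)
    simp only [Fin.val_succ, Nat.add_sub_add_right]

theorem transferredBracket_mem_grH (hη : A.IsSplitting η) (ha : ∀ i, a i ∈ A.grH η (deg i)) :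
    hη.transferredBracket n a ∈ A.grH η (∑ i, deg i + 2 - n) := by
  rcases lt_or_ge n 2 with hn | hn
  · rw [hη.transferredBracket_of_lt_two hn, zero_apply]
    exact Submodule.zero_mem _
  · change (hη.transferredBracket n a : L) ∈ A.gr _
    rw [hη.coe_transferredBracket hn ha]
    exact hη.treeBracket_mem_gr hn ha

theorem transferredBracket_antisymm (hη : A.IsSplitting η) (ha : ∀ i, a i ∈ A.grH η (deg i))
    (σ : Equiv.Perm (Fin n)) : hη.transferredBracket n (fun i => a (σ i)) =
      koszulChi σ deg • hη.transferredBracket n a := by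
  rcases lt_or_ge n 2 with hn | hn
  · rw [hη.transferredBracket_of_lt_two hn, zero_apply, zero_apply, smul_zero]
  · refine Subtype.ext ?_
    rw [hη.coe_transferredBracket hn fun i => ha (σ i),
      treeBracket_antisymm hη hn (a := fun i => (a i : L)) ha,
      intUnits_smul_eq k, intUnits_smul_eq k, Submodule.coe_smul, hη.coe_transferredBracket hn ha]

theorem coe_transferredBracket_two_of_mem (hη : A.IsSplitting η) {i j : ℤ} {u v : A.H η}
    (hu : u ∈ A.grH η i) (hv : v ∈ A.grH η j) : (hη.transferredBracket 2 ![u, v] : L) =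
      A.bracket u v - A.d (η (A.bracket u v)) := by
  have homogeneous : ∀ l, ![u, v] l ∈ A.grH η (![i, j] l) := Fin.forall_fin_two.2 ⟨hu, hv⟩
  rw [hη.coe_transferredBracket le_rfl homogeneous,
    treeBracket_two hη (a := fun l => (![u, v] l : L)) homogeneous]
  change A.bracket u v - (A.d (η (A.bracket u v)) + η (A.d (A.bracket u v))) = _
  rw [hη.d_bracket_of_mem_H (u := (u : L)) hu u.2 v.2, map_zero, add_zero]

theorem coe_transferredBracket_two (hη : A.IsSplitting η) (u v : A.H η) :
    (hη.transferredBracket 2 ![u, v] : L) = A.bracket u v - A.d (η (A.bracket u v)) := by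
  let binaryBracket : A.H η →ₗ[k] A.H η →ₗ[k] L :=
    (MultilinearMap.ofSubsingletonₗ k k (A.H η) L (0 : Fin 1)).symm.toLinearMap ∘ₗ
      ((A.H η).subtype.compMultilinearMap (hη.transferredBracket 2)).curryLeft
  have binaryBracket_apply (x y : A.H η) :
      binaryBracket x y = (hη.transferredBracket 2 ![x, y] : L) :=
    congrArg (fun w => (hη.transferredBracket 2 w : L))
      (funext (Fin.forall_fin_two.2 ⟨rfl, rfl⟩))
  let projected : A.H η →ₗ[k] A.H η →ₗ[k] L :=
    (A.bracket.compl₁₂ (A.H η).subtype (A.H η).subtype).compr₂ (LinearMap.id - A.d ∘ₗ η)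
  have mem_span (w : A.H η) : w ∈ Submodule.span k (⋃ i, (A.grH η i : Set (A.H η))) := by
    rw [← Submodule.iSup_eq_span, hη.isInternal_grH.submodule_iSup_eq_top]
    exact Submodule.mem_top
  rw [← binaryBracket_apply]
  refine bilinear_eqOn_span (g := projected) (fun x hx y hy => ?_) u (mem_span u) v (mem_span v)
  obtain ⟨i, hx⟩ := Set.mem_iUnion.1 hx
  obtain ⟨j, hy⟩ := Set.mem_iUnion.1 hy
  exact (binaryBracket_apply x y).trans (hη.coe_transferredBracket_two_of_mem hx hy)

end DGLieAlgebra.IsSplitting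

theorem mainTheorem3 {k L : Type*} [CommRing k] [Invertible (2 : k)] [AddCommGroup L] [Module k L]
    (A : DGLieAlgebra k L) (η : L →ₗ[k] L) (hη : A.IsSplitting η) :
    ∃ μ : (n : ℕ) → MultilinearMap k (fun _ : Fin n => A.H η) (A.H η),
      IsMinimalLInfinityAlgebra (A.grH η) μ ∧
      (∀ a b : A.H η,
        (μ 2 ![a, b] : L) = A.bracket a b - A.d (η (A.bracket a b))) ∧
      (∀ n : ℕ, 2 ≤ n → ∀ (deg : Fin n → ℤ) (a : Fin n → A.H η),
        (∀ i, a i ∈ A.grH η (deg i)) →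
          (μ n a : L) = hη.treeBracket n deg (fun i => (a i : L))) := by
  refine ⟨hη.transferredBracket, ⟨⟨hη.isInternal_grH, ?degree, ?antisymm, ?jacobi⟩, ?mu_zero,
    ?mu_one⟩, hη.coe_transferredBracket_two, ?trees⟩
  case degree => exact fun n deg a ha => hη.transferredBracket_mem_grH ha
  case antisymm => exact fun n deg a ha σ => hη.transferredBracket_antisymm ha σ
  case jacobi => exact hη.transferredBracket_jacobi
  case mu_zero => exact hη.transferredBracket_of_lt_two Nat.zero_lt_two
  case mu_one => exact hη.transferredBracket_of_lt_two Nat.one_lt_two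
  case trees => exact fun n hn deg a ha => hη.coe_transferredBracket hn ha
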